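/- Let $Y$ be a closed oriented three-manifold with a triangulation (a finite simplicial complex whose realization is identified with $Y$ and in which the link of every $k$-simplex is a sphere of dimension $2-k$), with sets of edges $\mathrm{Edge}(Y)$ and of tetrahedra $\mathrm{Tet}(Y)$. A labelling is a map $l:\mathrm{Edge}(Y)\to[0,\pi]$ such that on every triangle with edge labels $l_1,l_2,l_3$ one has $l_i\le l_j+l_k$ for $\{i,j,k\}=\{1,2,3\}$ and $l_1+l_2+l_3\le 2\pi$, and such that on every tetrahedron $\tau$ the $4\times 4$ Gram matrix $(\cos l_{ab})$ (with $l_{aa}=0$) has positive determinant. Then every $\tau\in\mathrm{Tet}(Y)$ is realized, uniquely up to congruence, by a non-degenerate spherical tetrahedron in the unit sphere $S^3\subset\mathbb{R}^4$ with edge lengths $l$; let $\phi_{e,\tau}$ be its interior dihedral angle at the edge $e\subset\tau$. Let $s:\mathrm{Tet}(Y)\to\{\pm1\}$ be a sign assignment. The labelling $l$ is flat with respect to $s$ if $$\omega_{e,s}:=2\pi-\sum_{\tau\supset e}s(\tau)\,\phi_{e,\tau}\in 2\pi\mathbb{Z}\qquad\text{for all } e\in\mathrm{Edge}(Y).$$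 Suppose that $Y$ is simply connected and that $l$ is flat with respect to $s$. Then there is a continuous map $\varphi:Y\to S^3$ such that for every $\tau\in\mathrm{Tet}(Y)$ the restriction $\varphi|_\tau$ is an embedding of $\tau$ as a non-degenerate spherical tetrahedron with edge lengths given by $l$, with the standard parametrization $$\varphi\Big(\sum_i t_i v_i\Big)=\frac{\sum_i t_i\,\varphi(v_i)}{\big\|\sum_i t_i\,\varphi(v_i)\big\|}$$ in barycentric coordinates with respect to the vertices $v_0,\dots,v_3$ of $\tau$, and such that $\varphi|_\tau$ is orientation preserving if $s(\tau)=1$ and orientation reversing if $s(\tau)=-1$. If $\varphi':Y\to S^3$ is any other map with these properties, then there is $A\in SO(4)$ with $\varphi'=A\circ\varphi$. -/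

import Mathlib

open scoped BigOperators
open Matrix

noncomputable section

/-- Euclidean four-space. -/
abbrev E4 : Type := EuclideanSpace ℝ (Fin 4)

/-- The unit three-sphere in Euclidean four-space. -/
abbrev S3 : Type := Metric.sphere (0 : E4) 1

/-! ### Simplicial complexes on a finite vertex set -/

namespace PreAbstractSimplicialComplex

/-- The geometric realization of a simplicial complex with finitely many vertices, in barycentric
coordinates, with the subspace topology of `V → ℝ`. -/
def realization {V : Type*} [Fintype V] (K : PreAbstractSimplicialComplex V) : Set (V → ℝ) :=
  {t | t ∈ stdSimplex ℝ V ∧ ∃ σ ∈ K, ∀ v, t v ≠ 0 → v ∈ σ}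

/-- The link of the face `σ`: all faces disjoint from `σ` which together with `σ` span a face. -/
def link {V : Type*} [DecidableEq V] (K : PreAbstractSimplicialComplex V) (σ : Finset V) :
    PreAbstractSimplicialComplex V where
  faces := {ρ | ρ.Nonempty ∧ Disjoint ρ σ ∧ ρ ∪ σ ∈ K.faces}
  isRelLowerSet_faces := by
    rintro ρ ⟨h1, h2, h3⟩
    refine ⟨h1, fun ρ' hle hne => ⟨hne, Finset.disjoint_of_subset_left hle h2, ?_⟩⟩
    exact (K.isRelLowerSet_faces h3).2 (Finset.union_subset_union_left hle)
      (hne.mono Finset.subset_union_left)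

/-- A finite simplicial complex is a closed (combinatorial) three-manifold when all its simplices
have dimension at most `3` and the link of every `k`-simplex is a sphere of dimension `2 - k`:
two-spheres around vertices, circles around edges, two points around triangles, and the empty
sphere around tetrahedra. (A simplex with `k + 1` vertices has dimension `k`, and the sphere of
dimension `2 - k` is the unit sphere of `ℝ ^ (4 - (k + 1))`.) -/
def IsClosedThreeManifold {V : Type*} [Fintype V] [DecidableEq V]
    (K : PreAbstractSimplicialComplex V) : Prop :=
  ∀ σ ∈ K, σ.card ≤ 4 ∧
    Nonempty ((K.link σ).realization ≃ₜ
      Metric.sphere (0 : EuclideanSpace ℝ (Fin (4 - σ.card))) 1)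

end PreAbstractSimplicialComplex

/-- A triangulation, with vertices in the finite type `V`, of the space `Y` as a closed
three-manifold. -/
structure ThreeManifoldTriangulation (Y : Type*) [TopologicalSpace Y]
    (V : Type*) [Fintype V] [DecidableEq V] where
  /-- the simplicial complex -/
  complex : PreAbstractSimplicialComplex V
  /-- it is a closed three-manifold -/
  isClosedThreeManifold : complex.IsClosedThreeManifold
  /-- its geometric realization is identified with `Y` -/
  homeo : complex.realization ≃ₜ Y

namespace ThreeManifoldTriangulation

variable {Y : Type*} [TopologicalSpace Y] {V : Type*} [Fintype V] [DecidableEq V]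

/-- The edges of the triangulation, as sets of two vertices. -/
def Edge (T : ThreeManifoldTriangulation Y V) : Set (Finset V) :=
  {e | e ∈ T.complex ∧ e.card = 2}

/-- The tetrahedra of the triangulation, as sets of four vertices. -/
def Tet (T : ThreeManifoldTriangulation Y V) : Set (Finset V) :=
  {τ | τ ∈ T.complex ∧ τ.card = 4}

/-- The closed subset of `Y` which is occupied by the simplex `σ`. -/
def cell (T : ThreeManifoldTriangulation Y V) (σ : Finset V) : Set Y :=
  T.homeo '' {t | ∀ v, t.1 v ≠ 0 → v ∈ σ}

/-- `x` is an ordering of the vertices of the tetrahedron `τ`. -/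
def IsOrdering (x : Fin 4 → V) (τ : Finset V) : Prop :=
  Function.Injective x ∧ Finset.univ.image x = τ

/-- An orientation of a triangulated closed three-manifold: every tetrahedron is oriented (the
orderings of its vertices are divided into positive and negative ones, and a permutation changes
the sign by its parity), and any two tetrahedra with a common triangle induce opposite
orientations on it. Only the values at orderings of tetrahedra matter. -/
structure Orientation (T : ThreeManifoldTriangulation Y V) where
  /-- the sign of an ordered tetrahedron -/
  sign : (Fin 4 → V) → ℤˣ
  /-- the sign is alternating -/
  sign_perm : ∀ τ ∈ T.Tet, ∀ x : Fin 4 → V, IsOrdering x τ → ∀ π : Equiv.Perm (Fin 4),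
    sign (x ∘ π) = Equiv.Perm.sign π * sign x
  /-- adjacent tetrahedra are oriented coherently -/
  coherent : ∀ τ ∈ T.Tet, ∀ τ' ∈ T.Tet, ∀ a b c d d' : V, d ≠ d' →
    IsOrdering ![a, b, c, d] τ → IsOrdering ![a, b, c, d'] τ' →
    sign ![a, b, c, d'] = - sign ![a, b, c, d]

/-! ### Labellings, dihedral angles and flatness

A labelling of the edges is a function `l : Finset V → ℝ`, a sign assignment of the tetrahedra is
a function `s : Finset V → ℤˣ`; only the values of `l` at edges and of `s` at tetrahedra matter. -/

/-- The spherical Gram matrix `(cos l_ab)` of a tetrahedron with ordered vertices `x`. -/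
def gramMatrix (l : Finset V → ℝ) (x : Fin 4 → V) : Matrix (Fin 4) (Fin 4) ℝ :=
  Matrix.of fun i j => if i = j then 1 else Real.cos (l {x i, x j})

/-- `l` takes values in `[0, π]` on edges, satisfies the inequalities of spherical triangles on
every triangle, and has positive Gram determinant on every tetrahedron. -/
structure IsLabelling (T : ThreeManifoldTriangulation Y V) (l : Finset V → ℝ) : Prop where
  mem_Icc : ∀ e ∈ T.Edge, l e ∈ Set.Icc 0 Real.pi
  triangle : ∀ a b c : V, a ≠ b → b ≠ c → a ≠ c → {a, b, c} ∈ T.complex →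
    l {a, c} ≤ l {a, b} + l {b, c} ∧ l {a, b} + l {b, c} + l {a, c} ≤ 2 * Real.pi
  gram_pos : ∀ τ ∈ T.Tet, ∀ x : Fin 4 → V, IsOrdering x τ → 0 < (gramMatrix l x).det

/-- The points `p v`, for `v ∈ τ`, are the vertices of a non-degenerate spherical tetrahedron
with edge lengths `l`. (The minor arc between two points of the sphere has as its length the angle
between them.) -/
def IsRealization (l : Finset V → ℝ) (τ : Finset V) (p : V → S3) : Prop :=
  LinearIndependent ℝ (fun v : τ => (p v : E4)) ∧
    ∀ v ∈ τ, ∀ w ∈ τ, v ≠ w →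
      InnerProductGeometry.angle (p v : E4) (p w : E4) = l {v, w}

/-- The interior dihedral angle at the edge `ab` of the spherical tetrahedron `abcd`: the angle
between the directions, perpendicular to the edge, in which the faces `abc` and `abd` leave it. -/
def dihedralAngleOfPoints (a b c d : S3) : ℝ :=
  InnerProductGeometry.angle
    ((Submodule.span ℝ {(a : E4), (b : E4)})ᗮ.starProjection (c : E4))
    ((Submodule.span ℝ {(a : E4), (b : E4)})ᗮ.starProjection (d : E4))

/-- `θ` is the interior dihedral angle at the edge `e` in a spherical tetrahedron with vertices
labelled by `τ` and with edge lengths `l`. -/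
def IsInteriorDihedralAngle (l : Finset V → ℝ) (e τ : Finset V) (θ : ℝ) : Prop :=
  ∃ (a b c d : V) (p : V → S3), e = {a, b} ∧ IsOrdering ![a, b, c, d] τ ∧
    IsRealization l τ p ∧ θ = dihedralAngleOfPoints (p a) (p b) (p c) (p d)

open Classical in
/-- The interior dihedral angle at the edge `e` in the spherical tetrahedron `τ` with edge
lengths `l`. For a labelling and an edge `e` of a tetrahedron `τ` such a spherical tetrahedron
exists and is unique up to congruence, so the angle does not depend on the choice. -/
def interiorDihedralAngle (l : Finset V → ℝ) (e τ : Finset V) : ℝ :=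
  if h : ∃ θ, IsInteriorDihedralAngle l e τ θ then h.choose else 0

open Classical in
/-- The defect angle around the edge `e`. -/
def defectAngle (T : ThreeManifoldTriangulation Y V) (l : Finset V → ℝ) (s : Finset V → ℤˣ)
    (e : Finset V) : ℝ :=
  2 * Real.pi - ∑ τ : Finset V with τ ∈ T.Tet ∧ e ⊆ τ,
    (((s τ : ℤˣ) : ℤ) : ℝ) * interiorDihedralAngle l e τ

/-- `l` is flat with respect to `s`: all defect angles vanish modulo `2π`. -/
def IsFlat (T : ThreeManifoldTriangulation Y V) (l : Finset V → ℝ) (s : Finset V → ℤˣ) : Prop :=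
  ∀ e ∈ T.Edge, ((T.defectAngle l s e : ℝ) : Real.Angle) = 0

/-! ### Maps to the three-sphere -/

/-- `φ : Y → S³` is continuous and embeds every tetrahedron `τ` as a non-degenerate spherical
tetrahedron with edge lengths `l`, parametrized in the standard way (central projection of
the affine parametrization by barycentric coordinates), and the embedding of `τ`
preserves the orientation if `s τ = 1` and reverses it if `s τ = -1`. (Four linearly independent
points of the sphere are positively ordered if they have positive determinant.)
Here `p v` is the image of the vertex `v`. -/
def IsSphericalMap (T : ThreeManifoldTriangulation Y V) (o : T.Orientation)
    (l : Finset V → ℝ) (s : Finset V → ℤˣ) (φ : Y → S3) : Prop :=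
  Continuous φ ∧
  (∀ τ ∈ T.Tet, Topology.IsEmbedding ((T.cell τ).domRestrict φ)) ∧
  ∃ p : V → S3,
    (∀ t : T.complex.realization,
      (φ (T.homeo t) : E4) = NormedSpace.normalize (∑ v, t.1 v • (p v : E4))) ∧
    (∀ τ ∈ T.Tet, IsRealization l τ p) ∧
    (∀ τ ∈ T.Tet, ∀ x : Fin 4 → V, IsOrdering x τ →
      0 < (((s τ * o.sign x : ℤˣ) : ℤ) : ℝ) *
        (Matrix.of fun i j : Fin 4 => (p (x i) : E4) j).det)

end ThreeManifoldTriangulation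

end

noncomputable section

open Topology Filter

/-! ### Locally constant cocycles -/

/-! The map is determined by the images of the vertices, so everything reduces to placing the
vertices in the unit sphere of $\mathbb{R}^4$ so that each tetrahedron has the prescribed Gram
matrix and the determinant sign dictated by $s$ and the orientation. Such a placement for the
tetrahedra around a simplex $\sigma$ is a development of the star of $\sigma$; taking
$\sigma=\emptyset$ gives the whole complex.

Two developments of a single tetrahedron differ by exactly one rotation, because equal Gram matrices
and equal determinant signs determine an element of $SO(4)$. A rotation is already determined by its
effect on three vertices of a non-degenerate tetrahedron, so the comparison rotations of adjacent
tetrahedra coincide. As the links are connected, any two developments of a star differ by one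
rotation (`hasUniqueDevelopment_of_mem`, `hasUniqueDevelopment_empty`).

Existence climbs from edges to vertices to the whole complex. Around an edge the tetrahedra form a
cycle, and each turns the angular coordinate by $s(\tau)\phi_{e,\tau}$; flatness says precisely that
the total turn vanishes modulo $2\pi$, so an explicit development closes up
(`exists_development_edge`). For a vertex or the empty simplex, developments exist on the stars of
the joins of $\sigma$ with the vertices of its link. By uniqueness they differ on overlaps by
rotations forming a constant Čech cocycle on the open-star cover of the link. This cocycle is a
coboundary since the link is $S^2$, respectively the simply connected complex itself, and the
corrected developments glue (`exists_development_of_link`).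

Normalizing barycentric combinations of the developed vertices yields $\varphi$. Any other map of
this kind also yields a development, so uniqueness of developments gives uniqueness up to $SO(4)$.
-/

/-- Every `G`-valued constant Čech cocycle on an open cover of `X` with index set `ι` is the
coboundary of locally constant functions. -/
def CocyclesTrivial (X : Type*) [TopologicalSpace X] (ι G : Type*) [Group G] : Prop :=
  ∀ (U : ι → Set X) (g : ι → ι → G), (∀ i, IsOpen (U i)) → (∀ x, ∃ i, x ∈ U i) →
    (∀ i j k x, x ∈ U i → x ∈ U j → x ∈ U k → g i j * g j k = g i k) →
    ∃ s : ι → X → G, (∀ i, ∀ x ∈ U i, ∀ᶠ y in 𝓝 x, s i y = s i x) ∧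
      ∀ i j x, x ∈ U i → x ∈ U j → s i x * g i j = s j x

namespace CocyclesTrivial

variable {X Y ι G : Type*} [TopologicalSpace X] [TopologicalSpace Y] [Group G]

/-- The cocycle glues copies of the discrete set `G` into a covering of `X`. Simple connectivity
lifts the identity to a global section, and reading that section in the charts gives the locally
constant functions. -/
theorem of_simplyConnectedSpace [SimplyConnectedSpace X] [LocallyPathConnectedSpace X] :
    CocyclesTrivial X ι G := by
  intro U g hU hcov hg
  choose ind hind using hcov
  have g_self : ∀ i x, x ∈ U i → g i i = 1 := fun i x hx => by
    simpa using hg i i i x hx hx hx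
  let _ : TopologicalSpace G := ⊥
  have : DiscreteTopology G := ⟨rfl⟩
  let Z : FiberBundleCore ι X G :=
    { baseSet := U
      isOpen_baseSet := hU
      indexAt := ind
      mem_baseSet_at := hind
      coordChange := fun i j _ h => h * g i j
      coordChange_self := fun i x hx h => by simp [g_self i x hx]
      continuousOn_coordChange := fun i j =>
        ((continuous_of_discreteTopology (f := fun h : G => h * g i j)).comp
          continuous_snd).continuousOn
      coordChange_comp := fun i j k x hx h => by
        rw [mul_assoc, hg i j k x hx.1.1 hx.1.2 hx.2] }
  have cov : IsCoveringMap (Bundle.TotalSpace.proj : Bundle.TotalSpace G Z.Fiber → X) :=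
    FiberBundle.isCoveringMap
  obtain ⟨x₀⟩ : Nonempty X := inferInstance
  obtain ⟨F, ⟨-, hF⟩, -⟩ := cov.existsUnique_continuousMap_lifts (ContinuousMap.id X) x₀
    (⟨x₀, (1 : G)⟩ : Bundle.TotalSpace G Z.Fiber) rfl
  have hF' : ∀ x, (F x).1 = x := fun x => congrFun hF x
  have key : ∀ i x, (Z.localTriv i (F x)).2 = (show G from (F x).2) * g (ind x) i := by
    intro i x
    change (show G from (F x).2) * g (ind (F x).1) i = _
    rw [hF']
  refine ⟨fun i x => (Z.localTriv i (F x)).2, fun i x hx => ?_, fun i j x hi hj => ?_⟩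
  · have h1 : ContinuousAt (Z.localTriv i) (F x) := by
      apply (Z.localTriv i).continuousAt
      rw [(Z.localTriv i).mem_source]
      change (F x).1 ∈ U i
      rwa [hF']
    have h2 : ContinuousAt (fun y => (Z.localTriv i (F y)).2) x :=
      continuous_snd.continuousAt.comp (h1.comp F.continuous.continuousAt)
    have h3 := h2.eventually_mem (IsOpen.mem_nhds (isOpen_discrete {(Z.localTriv i (F x)).2}) rfl)
    exact h3
  · change (Z.localTriv i (F x)).2 * g i j = (Z.localTriv j (F x)).2
    rw [key, key, mul_assoc, hg _ i j x (hind x) hi hj]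

theorem of_homeomorph (e : X ≃ₜ Y) (h : CocyclesTrivial X ι G) : CocyclesTrivial Y ι G := by
  intro U g hU hcov hg
  obtain ⟨s, hs, hs'⟩ := h (fun i => e ⁻¹' U i) g (fun i => (hU i).preimage e.continuous)
    (fun x => hcov (e x)) (fun i j k x => hg i j k (e x))
  refine ⟨fun i y => s i (e.symm y), fun i y hy => ?_, fun i j y hi hj => ?_⟩
  · exact e.symm.continuous.continuousAt.eventually (hs i (e.symm y) (by simpa using hy))
  · exact hs' i j (e.symm y) (by simpa using hi) (by simpa using hj)

/-- On the overlap the ratio of the two trivializations is independent of the index and locally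
constant, hence a single constant `c` because `A ∩ B` is connected. Multiplying the second
trivialization by `c` makes the two agree. -/
theorem of_isPreconnected_inter {A B : Set X} (hA : IsOpen A) (hB : IsOpen B)
    (hAB : A ∪ B = Set.univ) (hconn : IsPreconnected (A ∩ B))
    (tA : CocyclesTrivial A ι G) (tB : CocyclesTrivial B ι G) : CocyclesTrivial X ι G := by
  classical
  intro U g hU hcov hg
  have restr : ∀ {C : Set X}, IsOpen C → CocyclesTrivial C ι G → ∃ s : ι → X → G,
      (∀ i, ∀ x ∈ U i, x ∈ C → ∀ᶠ y in 𝓝 x, s i y = s i x) ∧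
      ∀ i j x, x ∈ C → x ∈ U i → x ∈ U j → s i x * g i j = s j x := by
    intro C hC tC
    obtain ⟨s, hs, hs'⟩ := tC (fun i => Subtype.val ⁻¹' U i) g
      (fun i => (hU i).preimage continuous_subtype_val) (fun x => hcov x)
      (fun i j k x => hg i j k x)
    refine ⟨fun i x => if hx : x ∈ C then s i ⟨x, hx⟩ else 1, fun i x hx hxC => ?_,
      fun i j x hxC hi hj => ?_⟩
    · have h1 := hs i ⟨x, hxC⟩ hx
      rw [← map_nhds_subtype_coe_eq_nhds (p := fun x => x ∈ C) hxC (hC.mem_nhds hxC)]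
      rw [eventually_map]
      filter_upwards [h1] with y hy
      simp [hxC, hy]
    · simpa [hxC] using hs' i j ⟨x, hxC⟩ hi hj
  obtain ⟨a, ha, ha'⟩ := restr hA tA
  obtain ⟨b, hb, hb'⟩ := restr hB tB
  obtain ⟨c, hc⟩ : ∃ c : G, ∀ i x, x ∈ A → x ∈ B → x ∈ U i → a i x = c * b i x := by
    choose ind hind using hcov
    have indep : ∀ x ∈ A ∩ B, ∀ i, x ∈ U i → a i x * (b i x)⁻¹ =
        a (ind x) x * (b (ind x) x)⁻¹ := by
      intro x hx i hi
      rw [← ha' i (ind x) x hx.1 hi (hind x), ← hb' i (ind x) x hx.2 hi (hind x)]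
      group
    obtain hE | ⟨x₀, hx₀⟩ := (A ∩ B).eq_empty_or_nonempty
    · exact ⟨1, fun i x h1 h2 => by have : x ∈ A ∩ B := ⟨h1, h2⟩; simp [hE] at this⟩
    · refine ⟨a (ind x₀) x₀ * (b (ind x₀) x₀)⁻¹, fun i x h1 h2 hi => ?_⟩
      let _ : TopologicalSpace G := ⊥
      have : DiscreteTopology G := ⟨rfl⟩
      have hcont : ContinuousOn (fun x => a (ind x) x * (b (ind x) x)⁻¹) (A ∩ B) := by
        intro x hx
        refine ContinuousAt.continuousWithinAt ?_
        refine (continuousAt_const (y := a (ind x) x * (b (ind x) x)⁻¹)).congr ?_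
        filter_upwards [ha (ind x) x (hind x) hx.1, hb (ind x) x (hind x) hx.2,
          (hU (ind x)).mem_nhds (hind x), (hA.inter hB).mem_nhds hx] with y e1 e2 e3 e4
        rw [← indep y e4 _ e3, e1, e2]
      have := hconn.constant hcont ⟨h1, h2⟩ hx₀
      rw [← this, ← indep x ⟨h1, h2⟩ i hi]
      group
  refine ⟨fun i x => if x ∈ A then a i x else c * b i x, fun i x hx => ?_, fun i j x hi hj => ?_⟩
  · by_cases hxA : x ∈ A
    · filter_upwards [ha i x hx hxA, hA.mem_nhds hxA] with y e1 e2
      simp [hxA, e1, e2]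
    · have hxB : x ∈ B := by
        have : x ∈ A ∪ B := hAB ▸ Set.mem_univ x
        exact this.resolve_left hxA
      filter_upwards [hb i x hx hxB, hB.mem_nhds hxB, (hU i).mem_nhds hx] with y e1 e2 e3
      by_cases hyA : y ∈ A
      · simp [hxA, hyA, hc i y hyA e2 e3, e1]
      · simp [hxA, hyA, e1]
  · by_cases hxA : x ∈ A
    · simpa [hxA] using ha' i j x hxA hi hj
    · have hxB : x ∈ B := by
        have : x ∈ A ∪ B := hAB ▸ Set.mem_univ x
        exact this.resolve_left hxA
      simp [hxA, mul_assoc, hb' i j x hxB hi hj]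

/-- The complements of two antipodal points are planes by stereographic projection, and they meet in
a punctured plane, which is connected. Keeping `n` variable lets the lemma apply to the dimension `4
- σ.card` of a vertex link. -/
theorem sphere_two (n : ℕ) (hn : n = 3) :
    CocyclesTrivial (Metric.sphere (0 : EuclideanSpace ℝ (Fin n)) 1) ι G := by
  subst hn
  have : Fact (Module.finrank ℝ (EuclideanSpace ℝ (Fin 3)) = 2 + 1) := ⟨by simp⟩
  let S := Metric.sphere (0 : EuclideanSpace ℝ (Fin 3)) 1
  have hv : ∃ v : S, True := by
    obtain ⟨v, hv⟩ := NormedSpace.sphere_nonempty (x := (0 : EuclideanSpace ℝ (Fin 3)))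
      (r := 1) |>.2 zero_le_one
    exact ⟨⟨v, hv⟩, trivial⟩
  obtain ⟨v, -⟩ := hv
  have chart : ∀ v : S, Nonempty (({v}ᶜ : Set S) ≃ₜ EuclideanSpace ℝ (Fin 2)) := by
    intro v
    refine ⟨((Homeomorph.setCongr (stereographic'_source (n := 2) v).symm).trans
      (stereographic' 2 v).toHomeomorphSourceTarget).trans
        ((Homeomorph.setCongr (stereographic'_target (n := 2) v)).trans
          (Homeomorph.Set.univ _))⟩
  have triv : ∀ v : S, CocyclesTrivial ({v}ᶜ : Set S) ι G := fun v => by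
    obtain ⟨e⟩ := chart v
    exact of_homeomorph e.symm of_simplyConnectedSpace
  have hne : -v ≠ v := fun h => by
    have h1 : (v : EuclideanSpace ℝ (Fin 3)) = 0 := by
      have := congrArg Subtype.val h
      ext i
      have h' : -(v : EuclideanSpace ℝ (Fin 3)) i = (v : EuclideanSpace ℝ (Fin 3)) i :=
        congrArg (fun w : EuclideanSpace ℝ (Fin 3) => w i) this
      simp only [PiLp.zero_apply]
      linarith
    have h2 : ‖(v : EuclideanSpace ℝ (Fin 3))‖ = 1 := norm_eq_of_mem_sphere v
    simp [h1] at h2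
  refine of_isPreconnected_inter (A := {v}ᶜ) (B := {-v}ᶜ) isOpen_compl_singleton
    isOpen_compl_singleton ?_ ?_ (triv v) (triv (-v))
  · ext x
    simp only [Set.mem_union, Set.mem_compl_iff, Set.mem_singleton_iff, Set.mem_univ, iff_true]
    by_contra! h
    exact hne (h.2.symm.trans h.1)
  · obtain ⟨e⟩ := chart v
    have h1 : IsPreconnected ({e ⟨-v, hne⟩}ᶜ : Set (EuclideanSpace ℝ (Fin 2))) := by
      refine (isConnected_compl_singleton_of_one_lt_rank ?_ _).isPreconnected
      rw [← Module.finrank_eq_rank]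
      simp
    have h2 := h1.image (fun y => (e.symm y : S))
      (continuous_subtype_val.comp e.symm.continuous).continuousOn
    convert h2 using 1
    ext x
    simp only [Set.mem_inter_iff, Set.mem_compl_iff, Set.mem_singleton_iff, Set.mem_image]
    constructor
    · rintro ⟨h3, h4⟩
      refine ⟨e ⟨x, h3⟩, fun h => h4 ?_, by simp⟩
      exact congrArg Subtype.val (e.injective h)
    · rintro ⟨y, h3, rfl⟩
      refine ⟨(e.symm y).2, fun h => h3 ?_⟩
      rw [← e.symm_apply_eq]
      exact Subtype.ext h

end CocyclesTrivial

end

noncomputable section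

open Topology Filter

/-! ### Realizations of simplicial complexes -/

namespace PreAbstractSimplicialComplex

variable {V : Type*} {K : PreAbstractSimplicialComplex V}

theorem mem_of_subset_of_mem {σ ρ : Finset V} (hσ : σ ∈ K) (h : ρ ⊆ σ) (hne : ρ.Nonempty) :
    ρ ∈ K :=
  (K.isRelLowerSet_faces hσ).2 h hne

theorem nonempty_of_mem {σ : Finset V} (hσ : σ ∈ K) : σ.Nonempty :=
  (K.isRelLowerSet_faces hσ).1

variable [Fintype V]

theorem realization_combination {x y : V → ℝ} (hx : x ∈ K.realization) (hy : y ∈ K.realization)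
    (hxy : ∀ v, x v ≠ 0 → y v ≠ 0) {a b : ℝ} (ha : 0 ≤ a) (hb : 0 ≤ b) (hab : a + b = 1) :
    a • x + b • y ∈ K.realization := by
  obtain ⟨hy, σ, hσ, hyσ⟩ := hy
  refine ⟨convex_stdSimplex ℝ V hx.1 hy ha hb hab, σ, hσ, fun v hv => hyσ v fun h0 => hv ?_⟩
  have : x v = 0 := by
    by_contra h
    exact hxy v h h0
  simp [this, h0]

/-- A point closer to `x` than every nonzero coordinate of `x` has those coordinates nonzero too.
Its face therefore contains `x` and the whole segment to `x`. -/
theorem starConvex_ball {x : V → ℝ} (hx : x ∈ K.realization) {r : ℝ} (hr0 : 0 < r)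
    (hr : ∀ v, x v ≠ 0 → r ≤ x v) : StarConvex ℝ x (K.realization ∩ Metric.ball x r) := by
  intro y hy a b ha hb hab
  refine ⟨realization_combination hx hy.1 (fun v hv h0 => ?_) ha hb hab,
    convex_ball x r (Metric.mem_ball_self hr0) hy.2 ha hb hab⟩
  have h1 := (dist_pi_lt_iff hr0).1 hy.2 v
  rw [h0, dist_comm, Real.dist_eq, sub_zero, abs_of_nonneg (hx.1.1 v)] at h1
  exact absurd (hr v hv) (not_le.2 h1)

/-- Small balls are star-shaped about their centres. Local path connectedness is what lifting to the
covering requires. -/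
instance : LocallyPathConnectedSpace K.realization := by
  have small : ∀ x : K.realization, ∃ ε > 0, ∀ v, x.1 v ≠ 0 → ε ≤ x.1 v := by
    intro x
    obtain hE | hne := (Finset.univ.filter fun v => x.1 v ≠ 0).eq_empty_or_nonempty
    · refine ⟨1, one_pos, fun v hv => ?_⟩
      simpa [hE] using (Finset.mem_filter.2 ⟨Finset.mem_univ v, hv⟩ :
        v ∈ Finset.univ.filter fun v => x.1 v ≠ 0)
    · obtain ⟨w, hw, hmin⟩ := Finset.exists_min_image _ (fun v => x.1 v) hne
      refine ⟨x.1 w, lt_of_le_of_ne (x.2.1.1 w) (Ne.symm (Finset.mem_filter.1 hw).2), ?_⟩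
      exact fun v hv => hmin v (Finset.mem_filter.2 ⟨Finset.mem_univ v, hv⟩)
  refine LocallyPathConnectedSpace.of_bases (ι := ℝ)
    (p := fun x r => 0 < r ∧ ∀ v, x.1 v ≠ 0 → r ≤ x.1 v) (s := fun x r => Metric.ball x r) ?_ ?_
  · intro x
    obtain ⟨ε, hε, hε'⟩ := small x
    refine Metric.nhds_basis_ball.to_hasBasis (fun r hr => ?_) (fun r hr => ⟨r, hr.1, le_rfl⟩)
    refine ⟨min r ε, ⟨lt_min hr hε, fun v hv => (min_le_right _ _).trans (hε' v hv)⟩, ?_⟩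
    exact Metric.ball_subset_ball (min_le_left _ _)
  · rintro x r ⟨hr0, hr⟩
    rw [IsInducing.subtypeVal.isPathConnected_iff]
    have : Subtype.val '' Metric.ball x r = K.realization ∩ Metric.ball x.1 r := by
      ext y
      constructor
      · rintro ⟨y, hy, rfl⟩
        exact ⟨y.2, hy⟩
      · rintro ⟨hy, hy'⟩
        exact ⟨⟨y, hy⟩, hy', rfl⟩
    rw [this]
    exact (starConvex_ball x.2 hr0 hr).isPathConnected ⟨x.2, Metric.mem_ball_self hr0⟩

/-- The open star of the vertex `v`. -/
def openStar (K : PreAbstractSimplicialComplex V) (v : V) : Set K.realization :=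
  {x | x.1 v ≠ 0}

theorem isOpen_openStar (v : V) : IsOpen (K.openStar v) :=
  isOpen_ne_fun ((continuous_apply v).comp continuous_subtype_val) continuous_const

theorem exists_mem_openStar (x : K.realization) : ∃ v, x ∈ K.openStar v := by
  by_contra! h
  have h1 := x.2.1.2
  have h2 : ∀ v, x.1 v = 0 := fun v => by simpa [openStar] using h v
  simp [h2] at h1

theorem mem_of_forall_mem_openStar {σ : Finset V} (hσ : σ.Nonempty) {x : K.realization}
    (h : ∀ v ∈ σ, x ∈ K.openStar v) : σ ∈ K := by
  obtain ⟨-, ρ, hρ, hx⟩ := x.2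
  exact mem_of_subset_of_mem hρ (fun v hv => hx v (h v hv)) hσ

/-- The barycentre of a face. -/
def barycentre (σ : Finset V) (hσ : σ ∈ K) : K.realization := by
  classical
  exact ⟨fun v => if v ∈ σ then (σ.card : ℝ)⁻¹ else 0, by
    have h : (σ.card : ℝ) ≠ 0 := by simpa using (nonempty_of_mem hσ).ne_empty
    refine ⟨⟨fun v => ?_, ?_⟩, σ, hσ, fun v hv => ?_⟩
    · dsimp only
      split_ifs <;> positivity
    · simp [Finset.sum_ite_mem, h]
    · by_contra h'
      simp [h'] at hv⟩

theorem barycentre_mem_openStar {σ : Finset V} (hσ : σ ∈ K) {v : V} (hv : v ∈ σ) :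
    barycentre σ hσ ∈ K.openStar v := by
  simpa [openStar, barycentre, hv] using (nonempty_of_mem hσ).ne_empty

/-- The open star is star-shaped about the vertex itself, which is the barycentre of `{v}`. -/
theorem isPreconnected_openStar {v : V} (hv : {v} ∈ K) : IsPreconnected (K.openStar v) := by
  rw [IsInducing.subtypeVal.isPreconnected_image.symm]
  have hb := barycentre_mem_openStar hv (Finset.mem_singleton_self v)
  refine (StarConvex.isPathConnected (a := (barycentre {v} hv).1) ?_
    (Set.mem_image_of_mem _ hb)).isConnected.isPreconnected
  rintro _ ⟨y, hy, rfl⟩ a b ha hb' hab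
  have hyv : 0 < y.1 v := lt_of_le_of_ne (y.2.1.1 v) (Ne.symm hy)
  refine ⟨⟨_, realization_combination (barycentre {v} hv).2 y.2 (fun w hw => ?_) ha hb' hab⟩,
    ?_, rfl⟩
  · obtain rfl : w = v := by
      by_contra h
      simp [barycentre, h] at hw
    exact hy
  · have h1 : (barycentre {v} hv).1 v = 1 := by simp [barycentre]
    change a * (barycentre {v} hv).1 v + b * y.1 v ≠ 0
    rw [h1]
    obtain h | h := ha.lt_or_eq
    · positivity
    · have : b = 1 := by linarith
      subst h this
      simpa using hyv.ne'

/-- Open stars have a common point only when their vertices span a face, so a simplicial cocycle is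
a Čech cocycle for the open-star cover. Its locally constant trivializations are constant on the
connected open stars, which leaves one group element per vertex. -/
theorem exists_trivialization {G : Type*} [Group G] [DecidableEq V]
    (h : CocyclesTrivial K.realization V G)
    (g : V → V → G) (hg : ∀ i j k, {i, j, k} ∈ K → g i j * g j k = g i k) :
    ∃ h : V → G, ∀ i j, {i, j} ∈ K → h i * g i j = h j := by
  classical
  obtain ⟨s, hs, hs'⟩ := h K.openStar g isOpen_openStar exists_mem_openStar
    (fun i j k x hi hj hk => hg i j k (mem_of_forall_mem_openStar (by simp) (x := x)
      (by simp [hi, hj, hk])))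
  have const : ∀ v (hv : {v} ∈ K) x, x ∈ K.openStar v → s v x = s v (barycentre {v} hv) := by
    intro v hv x hx
    let _ : TopologicalSpace G := ⊥
    have : DiscreteTopology G := ⟨rfl⟩
    refine (isPreconnected_openStar hv).constant (f := s v) (fun y hy => ?_) hx
      (barycentre_mem_openStar hv (Finset.mem_singleton_self v))
    exact ((continuousAt_const (y := s v y)).congr
      ((hs v y hy).mono fun z hz => hz.symm)).continuousWithinAt
  refine ⟨fun v => if hv : {v} ∈ K then s v (barycentre {v} hv) else 1, fun i j hij => ?_⟩
  have hi : {i} ∈ K := mem_of_subset_of_mem hij (by simp) (by simp)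
  have hj : {j} ∈ K := mem_of_subset_of_mem hij (by simp) (by simp)
  have hbi := barycentre_mem_openStar hij (v := i) (by simp)
  have hbj := barycentre_mem_openStar hij (v := j) (by simp)
  simp only [hi, hj, dif_pos]
  rw [← const i hi _ hbi, ← const j hj _ hbj, hs' i j _ hbi hbj]

/-- Assigning to a point the value of `f` at any vertex whose open star contains it is well defined
and locally constant. -/
theorem eq_of_preconnectedSpace [DecidableEq V] [PreconnectedSpace K.realization] {α : Type*}
    (f : V → α) (hf : ∀ i j, {i, j} ∈ K → f i = f j) {i j : V} (hi : {i} ∈ K) (hj : {j} ∈ K) :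
    f i = f j := by
  let _ : TopologicalSpace α := ⊥
  have : DiscreteTopology α := ⟨rfl⟩
  choose ind hind using exists_mem_openStar (K := K)
  have indep : ∀ x v, x ∈ K.openStar v → f (ind x) = f v := fun x v hv =>
    hf _ _ (mem_of_forall_mem_openStar (by simp) (x := x) (by simp [hind x, hv]))
  have hcont : Continuous fun x => f (ind x) := by
    refine continuous_iff_continuousAt.2 fun x => (continuousAt_const (y := f (ind x))).congr ?_
    filter_upwards [(isOpen_openStar (ind x)).mem_nhds (hind x)] with y hy
    exact (indep y _ hy).symm
  have := PreconnectedSpace.constant ‹_› hcont (x := barycentre {i} hi) (y := barycentre {j} hj)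
  rwa [indep _ i (barycentre_mem_openStar hi (by simp)),
    indep _ j (barycentre_mem_openStar hj (by simp))] at this

theorem isCompact_realization : IsCompact K.realization := by
  have : K.realization = ⋃ σ ∈ {σ | σ ∈ K}, stdSimplex ℝ V ∩ {t | ∀ v, v ∉ σ → t v = 0} := by
    ext t
    simp only [realization, Set.mem_ofPred_eq, Set.mem_iUnion, Set.mem_inter_iff, exists_prop]
    constructor
    · rintro ⟨h1, σ, h2, h3⟩
      exact ⟨σ, h2, h1, fun v hv => by_contra fun h => hv (h3 v h)⟩
    · rintro ⟨σ, h2, h1, h3⟩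
      exact ⟨h1, σ, h2, fun v hv => by_contra fun h => hv (h3 v h)⟩
  rw [this]
  refine (Set.toFinite _).isCompact_biUnion fun σ _ => (isCompact_stdSimplex ℝ V).inter_right ?_
  simp only [Set.ofPred_forall]
  exact isClosed_iInter fun v => isClosed_iInter fun _ =>
    isClosed_eq (continuous_apply v) continuous_const

end PreAbstractSimplicialComplex

end

noncomputable section

/-! ### Frames in Euclidean four-space -/

namespace Matrix

variable {n : Type*} [Fintype n] [DecidableEq n]

/-- The matrix `P⁻¹ * Q` is orthogonal because the Gram matrices agree. Its determinant is then ±1,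
and the common sign `ε` excludes -1. -/
theorem exists_specialOrthogonal_mul_transpose {P Q : Matrix n n ℝ} (h : P * Pᵀ = Q * Qᵀ)
    {ε : ℝ} (hP : 0 < ε * P.det) (hQ : 0 < ε * Q.det) :
    ∃ A ∈ specialOrthogonalGroup n ℝ, Q = P * Aᵀ := by
  have hP0 : P.det ≠ 0 := fun h0 => by simp [h0] at hP
  have hu : IsUnit P.det := isUnit_iff_ne_zero.2 hP0
  have hut : IsUnit (Pᵀ).det := by rwa [det_transpose]
  have hdet : P.det * P.det = Q.det * Q.det := by
    have := congrArg det h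
    simpa using this
  have hPQ : P.det = Q.det := by
    rcases mul_self_eq_mul_self_iff.1 hdet with h' | h'
    · exact h'
    · rw [h'] at hP
      nlinarith
  refine ⟨(P⁻¹ * Q)ᵀ, ?_, ?_⟩
  · rw [mem_specialOrthogonalGroup_iff, mem_orthogonalGroup_iff']
    constructor
    · change ((P⁻¹ * Q)ᵀ)ᵀ * (P⁻¹ * Q)ᵀ = 1
      rw [transpose_transpose, transpose_mul, transpose_nonsing_inv, Matrix.mul_assoc,
        ← Matrix.mul_assoc Q, ← h, Matrix.mul_assoc P, mul_nonsing_inv _ hut, Matrix.mul_one,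
        nonsing_inv_mul _ hu]
    · rw [det_transpose, det_mul, det_nonsing_inv, Ring.inverse_eq_inv', hPQ]
      exact inv_mul_cancel₀ (hPQ ▸ hP0)
  · rw [transpose_transpose, ← Matrix.mul_assoc, mul_nonsing_inv _ hu, Matrix.one_mul]

theorem mul_transpose_self_of_specialOrthogonal {A : Matrix n n ℝ}
    (hA : A ∈ specialOrthogonalGroup n ℝ) : Aᵀ * A = 1 :=
  (mem_orthogonalGroup_iff' n ℝ).1 (mem_specialOrthogonalGroup_iff.1 hA).1

/-- Two rotations which agree on all but one of the vectors of a basis are equal. -/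
theorem specialOrthogonal_eq_of_rows {A B P : Matrix n n ℝ} (k : n)
    (hA : A ∈ specialOrthogonalGroup n ℝ) (hB : B ∈ specialOrthogonalGroup n ℝ)
    (hP : P.det ≠ 0) (h : ∀ i ≠ k, A *ᵥ P i = B *ᵥ P i) : A = B := by
  have row : ∀ (C : Matrix n n ℝ) i, (P * Cᵀ) i = C *ᵥ P i := fun C i => by
    ext j
    simp [mul_apply, mulVec, dotProduct, mul_comm]
  set R := P * Aᵀ with hR
  set Q := P * Bᵀ with hQ
  have hrow : ∀ i ≠ k, R i = Q i := fun i hi => by rw [hR, hQ, row, row, h i hi]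
  have gram : ∀ C ∈ specialOrthogonalGroup n ℝ, (P * Cᵀ) * (P * Cᵀ)ᵀ = P * Pᵀ := by
    intro C hC
    rw [transpose_mul, transpose_transpose, Matrix.mul_assoc, ← Matrix.mul_assoc Cᵀ,
      mul_transpose_self_of_specialOrthogonal hC, Matrix.one_mul]
  have hRQ : R * Rᵀ = Q * Qᵀ := (gram A hA).trans (gram B hB).symm
  have hdetR : R.det = P.det := by
    rw [hR, det_mul, det_transpose, (mem_specialOrthogonalGroup_iff.1 hA).2, mul_one]
  have hdetQ : Q.det = P.det := by
    rw [hQ, det_mul, det_transpose, (mem_specialOrthogonalGroup_iff.1 hB).2, mul_one]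
  -- Equal Gram matrices make `u` orthogonal to all rows other than `k`, while equal determinants
  -- make `Q` with row `k` replaced by `u` singular. Pairing a linear relation among its rows with
  -- `u` leaves only the `k`-th term, which forces `u = 0`.
  set u := R k - Q k with hu
  have horth : ∀ i ≠ k, Q i ⬝ᵥ u = 0 := by
    intro i hi
    have h1 := congrFun (congrFun hRQ i) k
    change R i ⬝ᵥ R k = Q i ⬝ᵥ Q k at h1
    rw [hu, dotProduct_sub, ← h1, hrow i hi, sub_self]
  have hdet0 : (Q.updateRow k u).det = 0 := by
    have h1 : Q.updateRow k (R k) = R := by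
      ext i j
      by_cases hi : i = k
      · subst hi; simp
      · simp [hi, hrow i hi]
    have h2 : (Q.updateRow k (R k)).det = (Q.updateRow k u).det + (Q.updateRow k (Q k)).det := by
      rw [← det_updateRow_add, hu, sub_add_cancel]
    rw [h1, updateRow_eq_self, hdetR, hdetQ] at h2
    linarith
  obtain ⟨y, hy0, hy⟩ := exists_vecMul_eq_zero_iff.2 hdet0
  have hyk : y k * (u ⬝ᵥ u) = 0 := by
    have h1 : (y ᵥ* Q.updateRow k u) ⬝ᵥ u = 0 := by simp [hy]
    rw [← dotProduct_mulVec] at h1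
    rw [dotProduct, Finset.sum_eq_single k] at h1
    · simpa [mulVec] using h1
    · intro i _ hi
      have : (Q.updateRow k u *ᵥ u) i = 0 := by simpa [mulVec, hi] using horth i hi
      rw [this, mul_zero]
    · simp
  have hyk0 : y k ≠ 0 := by
    intro h0
    have : y ᵥ* Q = 0 := by
      rw [← hy]
      ext j
      refine Finset.sum_congr rfl fun i _ => ?_
      by_cases hi : i = k
      · subst hi; simp [h0]
      · simp [hi]
    exact hP (hdetQ ▸ exists_vecMul_eq_zero_iff.1 ⟨y, hy0, this⟩)
  have hu0 : u = 0 := dotProduct_self_eq_zero.1 ((mul_eq_zero.1 hyk).resolve_left hyk0)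
  have hRQ' : R = Q := by
    ext i j
    by_cases hi : i = k
    · subst hi
      have := congrFun hu0 j
      simp only [hu, Pi.sub_apply, Pi.zero_apply] at this
      linarith
    · rw [hrow i hi]
  have hinv := congrArg (P⁻¹ * ·) hRQ'
  simp only [hR, hQ, ← Matrix.mul_assoc, nonsing_inv_mul _ (isUnit_iff_ne_zero.2 hP),
    Matrix.one_mul] at hinv
  exact transpose_injective hinv

open scoped MatrixOrder in
theorem exists_mul_transpose_eq_of_posDef [Nonempty n] {M : Matrix n n ℝ} (hM : M.PosDef) {ε : ℝ}
    (hε : ε ≠ 0) : ∃ P : Matrix n n ℝ, P * Pᵀ = M ∧ 0 < ε * P.det := by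
  obtain ⟨B, hB⟩ := CStarAlgebra.nonneg_iff_eq_star_mul_self.1 hM.posSemidef.nonneg
  rw [star_eq_conjTranspose, conjTranspose_eq_transpose_of_trivial] at hB
  have hdet : B.det ≠ 0 := by
    intro h0
    have := hM.det_pos
    simp [hB, h0] at this
  obtain ⟨k⟩ := ‹Nonempty n›
  rcases lt_or_gt_of_ne (mul_ne_zero hε hdet) with h | h
  -- Negating one column reverses the sign of the determinant without changing the Gram matrix of
  -- the rows.
  · let D : Matrix n n ℝ := diagonal (Function.update 1 k (-1))
    have hD : D * D = 1 := by
      rw [diagonal_mul_diagonal, ← diagonal_one]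
      congr 1
      ext i
      by_cases hi : i = k
      · subst hi; simp
      · simp [hi]
    have hDdet : D.det = -1 := by
      rw [det_diagonal, Finset.prod_update_of_mem (Finset.mem_univ k)]
      simp
    refine ⟨Bᵀ * D, ?_, ?_⟩
    · rw [transpose_mul, transpose_transpose, diagonal_transpose, Matrix.mul_assoc,
        ← Matrix.mul_assoc D, hD, Matrix.one_mul, hB]
    · rw [det_mul, det_transpose, hDdet]
      linarith
  · exact ⟨Bᵀ, by rw [transpose_transpose, hB], by rwa [det_transpose]⟩

theorem det_fin_four_symmetric (u a b c d e f : ℝ) :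
    (!![u, a, b, c; a, u, d, e; b, d, u, f; c, e, f, u] : Matrix (Fin 4) (Fin 4) ℝ).det =
      u ^ 4 - u ^ 2 * (a ^ 2 + b ^ 2 + c ^ 2 + d ^ 2 + e ^ 2 + f ^ 2)
        + 2 * u * (a * b * d + a * c * e + b * c * f + d * e * f)
        + a ^ 2 * f ^ 2 + b ^ 2 * e ^ 2 + c ^ 2 * d ^ 2
        - 2 * (a * b * e * f + a * c * d * f + b * c * d * e) := by
  rw [det_succ_row_zero]
  simp [Fin.sum_univ_succ, det_fin_three, Fin.succAbove]
  ring

/-- A symmetric matrix of order four with unit diagonal, non-negative principal minors of order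
two and three, and positive determinant is positive definite. -/
theorem posDef_fin_four {a b c d e f : ℝ} (ha : a ^ 2 ≤ 1) (hb : b ^ 2 ≤ 1) (hc : c ^ 2 ≤ 1)
    (hd : d ^ 2 ≤ 1) (he : e ^ 2 ≤ 1) (hf : f ^ 2 ≤ 1)
    (h₁ : 0 ≤ 1 + 2 * a * b * d - a ^ 2 - b ^ 2 - d ^ 2)
    (h₂ : 0 ≤ 1 + 2 * a * c * e - a ^ 2 - c ^ 2 - e ^ 2)
    (h₃ : 0 ≤ 1 + 2 * b * c * f - b ^ 2 - c ^ 2 - f ^ 2)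
    (h₄ : 0 ≤ 1 + 2 * d * e * f - d ^ 2 - e ^ 2 - f ^ 2)
    (hdet : 0 < (!![1, a, b, c; a, 1, d, e; b, d, 1, f; c, e, f, 1] :
      Matrix (Fin 4) (Fin 4) ℝ).det) :
    (!![1, a, b, c; a, 1, d, e; b, d, 1, f; c, e, f, 1] : Matrix (Fin 4) (Fin 4) ℝ).PosDef := by
  set M : Matrix (Fin 4) (Fin 4) ℝ := !![1, a, b, c; a, 1, d, e; b, d, 1, f; c, e, f, 1] with hM
  have hH : M.IsHermitian := by
    ext i j
    fin_cases i <;> fin_cases j <;> simp [hM]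
  rw [hH.posDef_iff_eigenvalues_pos]
  intro i
  by_contra! hneg
  -- A non-positive eigenvalue `-t` would make `M + t • 1` singular. But its determinant is a
  -- polynomial in `t` whose coefficients are sums of principal minors, hence non-negative, with
  -- constant term `det M > 0`.
  set t := -hH.eigenvalues i with ht
  have ht0 : 0 ≤ t := by linarith
  have hpos : 0 < (M + t • (1 : Matrix (Fin 4) (Fin 4) ℝ)).det := by
    have h1 : M + t • (1 : Matrix (Fin 4) (Fin 4) ℝ) =
        !![1 + t, a, b, c; a, 1 + t, d, e; b, d, 1 + t, f; c, e, f, 1 + t] := by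
      ext i j
      fin_cases i <;> fin_cases j <;> simp [hM]
    rw [h1, det_fin_four_symmetric]
    rw [hM, det_fin_four_symmetric] at hdet
    have e1 := mul_nonneg ht0 (add_nonneg (add_nonneg (add_nonneg h₁ h₂) h₃) h₄)
    have e2 := mul_nonneg (pow_nonneg ht0 2) (show
      0 ≤ 6 - (a ^ 2 + b ^ 2 + c ^ 2 + d ^ 2 + e ^ 2 + f ^ 2) by linarith)
    have e3 := pow_nonneg ht0 3
    have e4 := pow_nonneg ht0 4
    linarith
  have hv : M *ᵥ (hH.eigenvectorBasis i).ofLp = hH.eigenvalues i • (hH.eigenvectorBasis i).ofLp :=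
    hH.mulVec_eigenvectorBasis i
  refine hpos.ne' (exists_mulVec_eq_zero_iff.1 ⟨(hH.eigenvectorBasis i).ofLp, ?_, ?_⟩)
  · intro h0
    exact hH.eigenvectorBasis.toBasis.ne_zero i (by simpa using h0)
  · rw [add_mulVec, hv, smul_mulVec, one_mulVec, ht, neg_smul, add_neg_cancel]

end Matrix

namespace Real

/-- The Gram determinant of a spherical triangle is non-negative. -/
theorem spherical_triangle_gram_nonneg {a b c : ℝ} (ha : a ∈ Set.Icc 0 π)
    (h₁ : a ≤ b + c) (h₂ : b ≤ a + c) (h₃ : c ≤ a + b)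
    (h₄ : a + b + c ≤ 2 * π) :
    0 ≤ 1 + 2 * cos a * cos b * cos c - cos a ^ 2 - cos b ^ 2 - cos c ^ 2 := by
  have e1 : cos a ≤ cos (b - c) := by
    rw [← cos_abs (b - c)]
    exact cos_le_cos_of_nonneg_of_le_pi (abs_nonneg _) ha.2 (abs_sub_le_iff.2 ⟨by linarith,
      by linarith⟩)
  have e2 : cos (b + c) ≤ cos a := by
    rcases le_total (b + c) π with h | h
    · exact cos_le_cos_of_nonneg_of_le_pi ha.1 h h₁
    · rw [← cos_two_pi_sub (b + c)]
      exact cos_le_cos_of_nonneg_of_le_pi ha.1 (by linarith) (by linarith)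
  -- The Gram determinant factors as $(\cos(b-c)-\cos a)(\cos a-\cos(b+c))$.
  have e3 := mul_nonneg (sub_nonneg.2 e1) (sub_nonneg.2 e2)
  rw [cos_sub, cos_add] at e3
  nlinarith [sin_sq_add_cos_sq b, sin_sq_add_cos_sq c, mul_self_nonneg (sin b * sin c),
    show (sin b * sin c) ^ 2 = (1 - cos b ^ 2) * (1 - cos c ^ 2) by
      rw [mul_pow, sin_sq, sin_sq]]

end Real

end

noncomputable section

/-! ### Developments -/

namespace ThreeManifoldTriangulation

section Orderings

variable {V : Type*} [DecidableEq V] {x y : Fin 4 → V} {τ : Finset V}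

theorem IsOrdering.mem (h : IsOrdering x τ) (i : Fin 4) : x i ∈ τ :=
  h.2 ▸ Finset.mem_image_of_mem _ (Finset.mem_univ i)

theorem IsOrdering.exists_eq (h : IsOrdering x τ) {v : V} (hv : v ∈ τ) : ∃ i, x i = v := by
  rw [← h.2] at hv
  simpa using hv

theorem IsOrdering.exists_perm (hx : IsOrdering x τ) (hy : IsOrdering y τ) :
    ∃ π : Equiv.Perm (Fin 4), y = x ∘ π := by
  choose f hf using fun i => hx.exists_eq (hy.mem i)
  have hinj : Function.Injective f := fun i j hij => hy.1 (by rw [← hf i, ← hf j, hij])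
  exact ⟨Equiv.ofBijective f (Finite.injective_iff_bijective.1 hinj), funext fun i => (hf i).symm⟩

theorem exists_isOrdering (h : τ.card = 4) : ∃ x, IsOrdering x τ := by
  let e := (τ.equivFinOfCardEq h).symm
  refine ⟨fun i => (e i : V), fun i j hij => e.injective (Subtype.ext hij), ?_⟩
  ext v
  simp only [Finset.mem_image, Finset.mem_univ, true_and]
  exact ⟨by rintro ⟨i, rfl⟩; exact (e i).2, fun hv => ⟨e.symm ⟨v, hv⟩, by simp⟩⟩

theorem isOrdering_vec {a b c d : V} (h : ({a, b, c, d} : Finset V).card = 4) :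
    IsOrdering ![a, b, c, d] {a, b, c, d} := by
  have himage : Finset.univ.image ![a, b, c, d] = {a, b, c, d} := by
    ext v
    simp [Fin.exists_fin_succ, eq_comm]
  refine ⟨Set.injOn_univ.1 (Finset.coe_univ (α := Fin 4) ▸ Finset.card_image_iff.1 ?_), himage⟩
  rw [himage, h, Finset.card_univ, Fintype.card_fin]

theorem IsOrdering.vec_eq {a b c d : V} (h : IsOrdering ![a, b, c, d] τ) : τ = {a, b, c, d} := by
  rw [← h.2]
  ext v
  simp [Fin.exists_fin_succ, eq_comm]

/-- The matrix with rows `p (x i)`. -/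
def frame {V : Type*} (p : V → Fin 4 → ℝ) (x : Fin 4 → V) : Matrix (Fin 4) (Fin 4) ℝ :=
  Matrix.of fun i => p (x i)

theorem frame_mulVec {V : Type*} (A : Matrix (Fin 4) (Fin 4) ℝ) (p : V → Fin 4 → ℝ)
    (x : Fin 4 → V) : frame (fun v => A *ᵥ p v) x = frame p x * Aᵀ := by
  ext i j
  simp [frame, mul_apply, mulVec, dotProduct, mul_comm]

theorem gramMatrix_comp (l : Finset V → ℝ) (x : Fin 4 → V) (π : Equiv.Perm (Fin 4)) :
    gramMatrix l (x ∘ π) = (gramMatrix l x).submatrix π π := by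
  ext i j
  simp [gramMatrix]

end Orderings

variable {Y : Type*} [TopologicalSpace Y] {V : Type*} [Fintype V] [DecidableEq V]

variable {T : ThreeManifoldTriangulation Y V} {o : T.Orientation} {l : Finset V → ℝ}
  {s : Finset V → ℤˣ} {p q : V → Fin 4 → ℝ} {σ τ : Finset V} {x : Fin 4 → V}

/-- The points `p (x i)` form a spherical tetrahedron with edge lengths `l`, whose orientation is
the one of `τ` if `s τ = 1` and the opposite one if `s τ = -1`. -/
def IsOrientedFrame (o : T.Orientation) (l : Finset V → ℝ) (s : Finset V → ℤˣ)
    (p : V → Fin 4 → ℝ) (τ : Finset V) (x : Fin 4 → V) : Prop :=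
  frame p x * (frame p x)ᵀ = gramMatrix l x ∧
    0 < (((s τ * o.sign x : ℤˣ) : ℤ) : ℝ) * (frame p x).det

/-- The points `p v` develop the star of `σ` to the three-sphere. -/
def IsDevelopment (o : T.Orientation) (l : Finset V → ℝ) (s : Finset V → ℤˣ)
    (σ : Finset V) (p : V → Fin 4 → ℝ) : Prop :=
  ∀ τ ∈ T.Tet, σ ⊆ τ → ∀ x, IsOrdering x τ → IsOrientedFrame o l s p τ x

theorem IsOrientedFrame.comp (hτ : τ ∈ T.Tet) (hx : IsOrdering x τ)
    (h : IsOrientedFrame o l s p τ x) (π : Equiv.Perm (Fin 4)) :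
    IsOrientedFrame o l s p τ (x ∘ π) := by
  have hf : frame p (x ∘ π) = (frame p x).submatrix π id := rfl
  refine ⟨?_, ?_⟩
  · rw [gramMatrix_comp, ← h.1, hf]
    rfl
  · rw [hf, det_permute, o.sign_perm τ hτ x hx π]
    have h1 : ((Equiv.Perm.sign π : ℤ) : ℝ) * ((Equiv.Perm.sign π : ℤ) : ℝ) = 1 := by
      norm_cast
      simp
    have h2 := h.2
    push_cast at h2 ⊢
    calc (0 : ℝ) < _ := h2
      _ = ((Equiv.Perm.sign π : ℤ) : ℝ) * ((Equiv.Perm.sign π : ℤ) : ℝ) *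
          ((s τ : ℤ) * (o.sign x : ℤ) * (frame p x).det) := by rw [h1, one_mul]
      _ = _ := by ring

theorem IsOrientedFrame.reorder (hτ : τ ∈ T.Tet) (hx : IsOrdering x τ)
    (h : IsOrientedFrame o l s p τ x) {y : Fin 4 → V} (hy : IsOrdering y τ) :
    IsOrientedFrame o l s p τ y := by
  obtain ⟨π, rfl⟩ := hx.exists_perm hy
  exact h.comp hτ hx π

theorem IsOrientedFrame.det_ne_zero (h : IsOrientedFrame o l s p τ x) : (frame p x).det ≠ 0 :=
  fun h0 => by simpa [h0] using h.2

theorem IsOrientedFrame.mulVec (h : IsOrientedFrame o l s p τ x) {A : Matrix (Fin 4) (Fin 4) ℝ}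
    (hA : A ∈ specialOrthogonalGroup (Fin 4) ℝ) :
    IsOrientedFrame o l s (fun v => A *ᵥ p v) τ x := by
  rw [IsOrientedFrame, frame_mulVec]
  refine ⟨?_, ?_⟩
  · rw [transpose_mul, transpose_transpose, Matrix.mul_assoc, ← Matrix.mul_assoc Aᵀ,
      mul_transpose_self_of_specialOrthogonal hA, Matrix.one_mul, h.1]
  · rw [det_mul, det_transpose, (mem_specialOrthogonalGroup_iff.1 hA).2, mul_one]
    exact h.2

theorem IsOrientedFrame.congr (h : IsOrientedFrame o l s p τ x) (hx : IsOrdering x τ)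
    (hpq : ∀ v ∈ τ, p v = q v) : IsOrientedFrame o l s q τ x := by
  have : frame q x = frame p x := by
    ext i j
    simp [frame, hpq _ (hx.mem i)]
  rwa [IsOrientedFrame, this]

theorem IsDevelopment.mono (h : IsDevelopment o l s σ p) {σ' : Finset V} (hσ : σ ⊆ σ') :
    IsDevelopment o l s σ' p :=
  fun τ hτ hστ => h τ hτ (hσ.trans hστ)

/-- The triangle conditions make the minors of order three non-negative, so positivity of the
determinant upgrades to positive definiteness; a factorization of the Gram matrix then supplies the
vertices. Positive definiteness is also recorded because the dihedral angle formulas depend on it.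
-/
theorem exists_isOrientedFrame (hl : T.IsLabelling l) (o : T.Orientation) (s : Finset V → ℤˣ)
    (hτ : τ ∈ T.Tet) (hx : IsOrdering x τ) :
    (gramMatrix l x).PosDef ∧ ∃ p, IsOrientedFrame o l s p τ x := by
  have face : ∀ ρ : Finset V, ρ ⊆ τ → ρ.Nonempty → ρ ∈ T.complex := fun ρ h1 h2 =>
    PreAbstractSimplicialComplex.mem_of_subset_of_mem hτ.1 h1 h2
  have symm : ∀ i j, l {x i, x j} = l {x j, x i} := fun i j => by rw [Finset.pair_comm]
  have edge : ∀ i j, i ≠ j → l {x i, x j} ∈ Set.Icc 0 Real.pi := fun i j hij =>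
    hl.mem_Icc _ ⟨face _ (by simp [Finset.insert_subset_iff, hx.mem]) (by simp),
      Finset.card_pair (hx.1.ne hij)⟩
  have tri : ∀ i j k, i ≠ j → j ≠ k → i ≠ k →
      l {x i, x k} ≤ l {x i, x j} + l {x j, x k} ∧
        l {x i, x j} + l {x j, x k} + l {x i, x k} ≤ 2 * Real.pi := fun i j k h1 h2 h3 =>
    hl.triangle _ _ _ (hx.1.ne h1) (hx.1.ne h2) (hx.1.ne h3)
      (face _ (by simp [Finset.insert_subset_iff, hx.mem]) (by simp))
  have minor : ∀ i j k, i ≠ j → j ≠ k → i ≠ k →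
      0 ≤ 1 + 2 * Real.cos (l {x i, x j}) * Real.cos (l {x i, x k}) * Real.cos (l {x j, x k})
        - Real.cos (l {x i, x j}) ^ 2 - Real.cos (l {x i, x k}) ^ 2
        - Real.cos (l {x j, x k}) ^ 2 := fun i j k h1 h2 h3 => by
    have t1 := tri i j k h1 h2 h3
    have t2 := (tri i k j h3 h2.symm h1).1
    have t3 := (tri j i k h1.symm h3 h2).1
    rw [symm k j] at t2
    rw [symm j i] at t3
    exact Real.spherical_triangle_gram_nonneg (edge i j h1) (by linarith) (by linarith)
      (by linarith) (by linarith)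
  have hM : gramMatrix l x = !![1, Real.cos (l {x 0, x 1}), Real.cos (l {x 0, x 2}),
      Real.cos (l {x 0, x 3}); Real.cos (l {x 0, x 1}), 1, Real.cos (l {x 1, x 2}),
      Real.cos (l {x 1, x 3}); Real.cos (l {x 0, x 2}), Real.cos (l {x 1, x 2}), 1,
      Real.cos (l {x 2, x 3}); Real.cos (l {x 0, x 3}), Real.cos (l {x 1, x 3}),
      Real.cos (l {x 2, x 3}), 1] := by
    ext i j
    fin_cases i <;> fin_cases j <;>
      simp [gramMatrix, symm 1 0, symm 2 0, symm 3 0, symm 2 1, symm 3 1, symm 3 2]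
  have hpos : (gramMatrix l x).PosDef := by
    have hdet := hl.gram_pos τ hτ x hx
    rw [hM] at hdet ⊢
    exact posDef_fin_four (Real.cos_sq_le_one _) (Real.cos_sq_le_one _) (Real.cos_sq_le_one _)
      (Real.cos_sq_le_one _) (Real.cos_sq_le_one _) (Real.cos_sq_le_one _)
      (minor 0 1 2 (by decide) (by decide) (by decide))
      (minor 0 1 3 (by decide) (by decide) (by decide))
      (minor 0 2 3 (by decide) (by decide) (by decide))
      (minor 1 2 3 (by decide) (by decide) (by decide)) hdet
  refine ⟨hpos, ?_⟩
  obtain ⟨P, hP, hPdet⟩ := exists_mul_transpose_eq_of_posDef hpos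
    (ε := (((s τ * o.sign x : ℤˣ) : ℤ) : ℝ)) (by
      exact_mod_cast Units.ne_zero (s τ * o.sign x))
  have hfr : frame (fun v => P (Function.invFun x v)) x = P := by
    ext i j
    simp [frame, Function.leftInverse_invFun hx.1 i]
  exact ⟨fun v => P (Function.invFun x v), by rw [hfr, hP], by rwa [hfr]⟩

/-! ### Faces of tetrahedra and uniqueness of developments -/

theorem exists_mem_link_of_sphere {n : ℕ} (hn : 0 < n)
    (e : (T.complex.link σ).realization ≃ₜ Metric.sphere (0 : EuclideanSpace ℝ (Fin n)) 1) :
    ∃ w ∉ σ, insert w σ ∈ T.complex := by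
  have : Nonempty (Fin n) := ⟨⟨0, hn⟩⟩
  obtain ⟨u, hu⟩ := NormedSpace.sphere_nonempty (x := (0 : EuclideanSpace ℝ (Fin n)))
    (r := 1) |>.2 zero_le_one
  obtain ⟨-, ρ, hρ, -⟩ := (e.symm ⟨u, hu⟩).2
  obtain ⟨⟨w, hw⟩, hd, hρσ⟩ := hρ
  exact ⟨w, Finset.disjoint_left.1 hd hw, PreAbstractSimplicialComplex.mem_of_subset_of_mem hρσ
    (Finset.insert_subset (Finset.mem_union_left _ hw) Finset.subset_union_right) (by simp)⟩

/-- The link of a simplex with fewer than four vertices is a non-empty sphere, so the simplex can be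
enlarged. -/
theorem exists_tet_of_mem (hσ : σ ∈ T.complex) : ∃ τ ∈ T.Tet, σ ⊆ τ := by
  induction h : 4 - σ.card generalizing σ with
  | zero =>
    have := (T.isClosedThreeManifold σ hσ).1
    exact ⟨σ, ⟨hσ, by omega⟩, subset_rfl⟩
  | succ n ih =>
    obtain ⟨-, ⟨e⟩⟩ := T.isClosedThreeManifold σ hσ
    obtain ⟨w, hw, hwσ⟩ := exists_mem_link_of_sphere (by omega) e
    obtain ⟨τ, hτ, hsub⟩ := ih hwσ (by rw [Finset.card_insert_of_notMem hw]; omega)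
    exact ⟨τ, hτ, (Finset.subset_insert _ _).trans hsub⟩

/-- Any two developments of the star of `σ` differ by a rotation. -/
def HasUniqueDevelopment (o : T.Orientation) (l : Finset V → ℝ) (s : Finset V → ℤˣ)
    (σ : Finset V) : Prop :=
  ∀ p q, IsDevelopment o l s σ p → IsDevelopment o l s σ q →
    ∃ A ∈ specialOrthogonalGroup (Fin 4) ℝ, ∀ τ ∈ T.Tet, σ ⊆ τ → ∀ v ∈ τ, q v = A *ᵥ p v

theorem IsOrientedFrame.exists_rotation (hx : IsOrdering x τ) (hp : IsOrientedFrame o l s p τ x)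
    (hq : IsOrientedFrame o l s q τ x) :
    ∃ A ∈ specialOrthogonalGroup (Fin 4) ℝ, ∀ v ∈ τ, q v = A *ᵥ p v := by
  obtain ⟨A, hA, hpq⟩ := exists_specialOrthogonal_mul_transpose (hp.1.trans hq.1.symm) hp.2 hq.2
  refine ⟨A, hA, fun v hv => ?_⟩
  obtain ⟨i, rfl⟩ := hx.exists_eq hv
  rw [← frame_mulVec] at hpq
  exact congrFun hpq i

/-- A rotation is determined by its values at the vertices of a triangle. -/
theorem IsDevelopment.rotation_unique (hp : IsDevelopment o l s σ p) {ρ : Finset V}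
    (hρ : ρ ∈ T.complex) (hσρ : σ ⊆ ρ) (hcard : 3 ≤ ρ.card) {A B : Matrix (Fin 4) (Fin 4) ℝ}
    (hA : A ∈ specialOrthogonalGroup (Fin 4) ℝ) (hB : B ∈ specialOrthogonalGroup (Fin 4) ℝ)
    (h : ∀ v ∈ ρ, A *ᵥ p v = B *ᵥ p v) : A = B := by
  obtain ⟨τ, hτ, hρτ⟩ := exists_tet_of_mem hρ
  obtain ⟨x, hx⟩ := exists_isOrdering hτ.2
  have hdiff : (τ \ ρ).card ≤ 1 := by
    have := Finset.card_sdiff_add_card_eq_card hρτ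
    have := hτ.2
    omega
  -- At most one vertex of `τ` lies outside `ρ`; `k` is its index, or 0 if there is none.
  obtain ⟨k, hk⟩ : ∃ k : Fin 4, ∀ i ≠ k, x i ∈ ρ := by
    by_cases hall : ∀ i, x i ∈ ρ
    · exact ⟨0, fun i _ => hall i⟩
    · push Not at hall
      obtain ⟨k, hk⟩ := hall
      refine ⟨k, fun i hi => by_contra fun hi' => hi (hx.1 ?_)⟩
      exact Finset.card_le_one.1 hdiff _ (Finset.mem_sdiff.2 ⟨hx.mem i, hi'⟩) _
        (Finset.mem_sdiff.2 ⟨hx.mem k, hk⟩)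
  exact specialOrthogonal_eq_of_rows k hA hB (hp τ hτ (hσρ.trans hρτ) x hx).det_ne_zero
    fun i hi => h _ (hk i hi)

/-- All tetrahedra containing `σ` share at least three vertices, on which their comparison rotations
agree. -/
theorem hasUniqueDevelopment_of_three_le_card (hσ : σ ∈ T.complex) (hcard : 3 ≤ σ.card) :
    HasUniqueDevelopment o l s σ := by
  intro p q hp hq
  obtain ⟨τ₀, hτ₀, hσ₀⟩ := exists_tet_of_mem hσ
  obtain ⟨x₀, hx₀⟩ := exists_isOrdering hτ₀.2
  obtain ⟨A, hA, hA'⟩ := (hp τ₀ hτ₀ hσ₀ x₀ hx₀).exists_rotation hx₀ (hq τ₀ hτ₀ hσ₀ x₀ hx₀)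
  refine ⟨A, hA, fun τ hτ hστ v hv => ?_⟩
  obtain ⟨x, hx⟩ := exists_isOrdering hτ.2
  obtain ⟨B, hB, hB'⟩ := (hp τ hτ hστ x hx).exists_rotation hx (hq τ hτ hστ x hx)
  rw [hp.rotation_unique hσ subset_rfl hcard hA hB fun w hw => by
    rw [← hA' w (hσ₀ hw), ← hB' w (hστ hw)]]
  exact hB' v hv

theorem mem_link_singleton {w : V} : {w} ∈ T.complex.link σ ↔ w ∉ σ ∧ insert w σ ∈ T.complex := by
  change (_ ∧ _ ∧ _) ↔ _
  rw [Finset.singleton_union, Finset.disjoint_singleton_left]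
  exact and_iff_right (Finset.singleton_nonempty w)

theorem exists_insert_of_card_lt (hτ : τ ∈ T.Tet) (hστ : σ ⊆ τ) (hcard : σ.card < 4) :
    ∃ w ∈ τ, {w} ∈ T.complex.link σ := by
  obtain ⟨w, hw, hw'⟩ := Finset.exists_mem_notMem_of_card_lt_card (hτ.2.symm ▸ hcard)
  exact ⟨w, hw, mem_link_singleton.2 ⟨hw', PreAbstractSimplicialComplex.mem_of_subset_of_mem hτ.1
    (Finset.insert_subset hw hστ) (by simp)⟩⟩

theorem insert_insert_mem {i j : V} (h : {i, j} ∈ T.complex.link σ) :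
    insert i (insert j σ) ∈ T.complex := by
  have := h.2.2
  rwa [Finset.insert_union, Finset.singleton_union] at this

/-- The comparison rotations at two adjacent vertices of the link agree on a common tetrahedron and
are therefore equal; connectedness of the link propagates this to all its vertices. -/
theorem hasUniqueDevelopment_of_link [PreconnectedSpace (T.complex.link σ).realization]
    (hcard : σ.card < 4)
    (h : ∀ w, {w} ∈ T.complex.link σ → HasUniqueDevelopment o l s (insert w σ)) :
    HasUniqueDevelopment o l s σ := by
  intro p q hp hq
  have : ∀ w, ∃ A ∈ specialOrthogonalGroup (Fin 4) ℝ, {w} ∈ T.complex.link σ →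
      ∀ τ ∈ T.Tet, insert w σ ⊆ τ → ∀ v ∈ τ, q v = A *ᵥ p v := by
    intro w
    by_cases hw : {w} ∈ T.complex.link σ
    · obtain ⟨A, hA, hA'⟩ := h w hw p q (hp.mono (Finset.subset_insert _ _))
        (hq.mono (Finset.subset_insert _ _))
      exact ⟨A, hA, fun _ => hA'⟩
    · exact ⟨1, one_mem _, fun hw' => absurd hw' hw⟩
  choose A hA hA' using this
  have hadj : ∀ i j, {i, j} ∈ T.complex.link σ → A i = A j := by
    intro i j hij
    obtain ⟨τ, hτ, hsub⟩ := exists_tet_of_mem (insert_insert_mem hij)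
    simp only [Finset.insert_subset_iff] at hsub
    have hi : {i} ∈ T.complex.link σ :=
      PreAbstractSimplicialComplex.mem_of_subset_of_mem hij (by simp) (by simp)
    have hj : {j} ∈ T.complex.link σ :=
      PreAbstractSimplicialComplex.mem_of_subset_of_mem hij (by simp) (by simp)
    refine hp.rotation_unique hτ.1 hsub.2.2 (by rw [hτ.2]; norm_num) (hA i) (hA j) fun v hv => ?_
    rw [← hA' i hi τ hτ (Finset.insert_subset hsub.1 hsub.2.2) v hv,
      ← hA' j hj τ hτ (Finset.insert_subset hsub.2.1 hsub.2.2) v hv]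
  by_cases hex : ∃ w, {w} ∈ T.complex.link σ
  · obtain ⟨w₀, hw₀⟩ := hex
    refine ⟨A w₀, hA w₀, fun τ hτ hστ v hv => ?_⟩
    obtain ⟨w, hwτ, hw⟩ := exists_insert_of_card_lt hτ hστ hcard
    rw [PreAbstractSimplicialComplex.eq_of_preconnectedSpace A hadj hw₀ hw]
    exact hA' w hw τ hτ (Finset.insert_subset hwτ hστ) v hv
  · refine ⟨1, one_mem _, fun τ hτ hστ v hv => ?_⟩
    obtain ⟨w, -, hw⟩ := exists_insert_of_card_lt hτ hστ hcard
    exact absurd ⟨w, hw⟩ hex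

/-- Developments of the stars of the vertices of the link of `σ` can be matched if the link is
simply connected. -/
theorem exists_development_of_link [PreconnectedSpace (T.complex.link σ).realization]
    (hcard : σ.card < 4)
    (htriv : CocyclesTrivial (T.complex.link σ).realization V (specialOrthogonalGroup (Fin 4) ℝ))
    (huniq : ∀ i j, {i, j} ∈ T.complex.link σ →
      HasUniqueDevelopment o l s (insert i (insert j σ)))
    (hex : ∀ w, {w} ∈ T.complex.link σ → ∃ p, IsDevelopment o l s (insert w σ) p) :
    ∃ p, IsDevelopment o l s σ p := by
  have hex' : ∀ w, ∃ p, {w} ∈ T.complex.link σ → IsDevelopment o l s (insert w σ) p := by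
    intro w
    by_cases hw : {w} ∈ T.complex.link σ
    · obtain ⟨p, hp⟩ := hex w hw
      exact ⟨p, fun _ => hp⟩
    · exact ⟨0, fun h => absurd h hw⟩
  choose p hp using hex'
  have single : ∀ {ρ : Finset V} {w : V}, ρ ∈ T.complex.link σ → w ∈ ρ →
      {w} ∈ T.complex.link σ := fun hρ hw =>
    PreAbstractSimplicialComplex.mem_of_subset_of_mem hρ (by simpa using hw) (by simp)
  have hg : ∀ i j, ∃ g : specialOrthogonalGroup (Fin 4) ℝ, {i, j} ∈ T.complex.link σ →
      ∀ τ ∈ T.Tet, insert i (insert j σ) ⊆ τ → ∀ v ∈ τ, p i v = g.1 *ᵥ p j v := by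
    intro i j
    by_cases hij : {i, j} ∈ T.complex.link σ
    · obtain ⟨A, hA, hA'⟩ := huniq i j hij (p j) (p i)
        ((hp j (single hij (by simp))).mono (Finset.subset_insert _ _))
        ((hp i (single hij (by simp))).mono (Finset.insert_subset_insert _
          (Finset.subset_insert _ _)))
      exact ⟨⟨A, hA⟩, fun _ => hA'⟩
    · exact ⟨1, fun h => absurd h hij⟩
  choose g hg using hg
  have hsub : ∀ {ρ ρ' : Finset V}, ρ ∈ T.complex.link σ → ρ' ⊆ ρ → ρ'.Nonempty →
      ρ' ∈ T.complex.link σ := PreAbstractSimplicialComplex.mem_of_subset_of_mem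
  -- On a tetrahedron containing `i`, `j`, `k` both `g i j * g j k` and `g i k` carry `p k` to `p
  -- i`, so they are the same rotation.
  obtain ⟨h, hh⟩ := PreAbstractSimplicialComplex.exists_trivialization htriv g (by
    intro i j k hijk
    have hik := hsub hijk (ρ' := {i, k}) (by simp [Finset.insert_subset_iff]) (by simp)
    have hij := hsub hijk (ρ' := {i, j}) (by simp [Finset.insert_subset_iff]) (by simp)
    have hjk := hsub hijk (ρ' := {j, k}) (by simp) (by simp)
    obtain ⟨τ, hτ, hτ'⟩ := exists_tet_of_mem (T := T) (σ := {i, j, k} ∪ σ) hijk.2.2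
    have hi : i ∈ τ := hτ' (by simp)
    have hj : j ∈ τ := hτ' (by simp)
    have hk : k ∈ τ := hτ' (by simp)
    have hσ : σ ⊆ τ := Finset.subset_union_right.trans hτ'
    refine Subtype.ext ((hp k (single hijk (by simp))).rotation_unique hτ.1
      (Finset.insert_subset hk hσ) (by rw [hτ.2]; norm_num) (g i j * g j k).2 (g i k).2
      fun v hv => ?_)
    rw [← hg i k hik τ hτ (by simp [Finset.insert_subset_iff, *]) v hv,
      hg i j hij τ hτ (by simp [Finset.insert_subset_iff, *]) v hv,
      hg j k hjk τ hτ (by simp [Finset.insert_subset_iff, *]) v hv, mulVec_mulVec]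
    rfl)
  have agree : ∀ i j, {i, j} ∈ T.complex.link σ → ∀ τ ∈ T.Tet, insert i (insert j σ) ⊆ τ →
      ∀ v ∈ τ, (h i).1 *ᵥ p i v = (h j).1 *ᵥ p j v := by
    intro i j hij τ hτ hτ' v hv
    rw [hg i j hij τ hτ hτ' v hv, mulVec_mulVec, ← hh i j hij]
    rfl
  by_cases hne : ∃ w, {w} ∈ T.complex.link σ
  swap
  · refine ⟨0, fun τ hτ hστ => ?_⟩
    obtain ⟨w, -, hw⟩ := exists_insert_of_card_lt hτ hστ hcard
    exact absurd ⟨w, hw⟩ hne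
  obtain ⟨w₀, hw₀⟩ := hne
  -- The vertices of `σ` belong to every local star. Their corrected positions agree along edges of
  -- the link, hence everywhere on it.
  have base : ∀ w, {w} ∈ T.complex.link σ → ∀ v ∈ σ,
      (h w).1 *ᵥ p w v = (h w₀).1 *ᵥ p w₀ v := by
    intro w hw v hv
    refine PreAbstractSimplicialComplex.eq_of_preconnectedSpace
      (fun w => (h w).1 *ᵥ p w v) (fun i j hij => ?_) hw hw₀
    obtain ⟨τ, hτ, hτ'⟩ := exists_tet_of_mem (insert_insert_mem hij)
    exact agree i j hij τ hτ hτ' v (hτ' (by simp [hv]))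
  -- A vertex outside `σ` takes its position from its own local development; by `agree` any
  -- neighbouring development gives the same point.
  refine ⟨fun v => if v ∈ σ then (h w₀).1 *ᵥ p w₀ v else (h v).1 *ᵥ p v v,
    fun τ hτ hστ x hx => ?_⟩
  obtain ⟨w, hwτ, hw⟩ := exists_insert_of_card_lt hτ hστ hcard
  refine ((hp w hw τ hτ (Finset.insert_subset hwτ hστ) x hx).mulVec (h w).2).congr hx
    fun v hv => ?_
  by_cases hvσ : v ∈ σ
  · simp only [hvσ, if_true]
    exact base w hw v hvσ
  · simp only [hvσ, if_false]
    refine agree w v ⟨by simp, ?_, ?_⟩ τ hτ (by simp [Finset.insert_subset_iff, *]) v hv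
    · have := (mem_link_singleton.1 hw).1
      rw [Finset.disjoint_left]
      intro a ha
      rcases Finset.mem_insert.1 ha with rfl | ha
      · exact this
      · rwa [Finset.mem_singleton.1 ha]
    · exact PreAbstractSimplicialComplex.mem_of_subset_of_mem hτ.1
        (by simp [Finset.insert_subset_iff, *]) (by simp)

end ThreeManifoldTriangulation

end

noncomputable section

/-! ### Dihedral angles -/

/-- The inner product of the projections of `c` and `d` to the orthogonal complement of the span
of two unit vectors `a`, `b`, where `k = ⟪a, b⟫` and the other arguments are the inner products
of the vectors indicated by their names. -/
def dihedralInner (k ac ad bc bd cd : ℝ) : ℝ :=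
  cd - (ac * ad + bc * bd - k * (ac * bd + ad * bc)) / (1 - k ^ 2)

/-- The component in the span of `a` and `b` is found by inverting their 2 × 2 Gram matrix, which
has determinant `1 - k ^ 2`. -/
theorem inner_starProjection_orthogonal_span_pair {E : Type*} [NormedAddCommGroup E]
    [InnerProductSpace ℝ E] [FiniteDimensional ℝ E] {a b : E} (c d : E) (ha : ‖a‖ = 1)
    (hb : ‖b‖ = 1) (hk : 1 - inner ℝ a b ^ 2 ≠ 0) :
    inner ℝ ((Submodule.span ℝ {a, b})ᗮ.starProjection c)
      ((Submodule.span ℝ {a, b})ᗮ.starProjection d) =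
      dihedralInner (inner ℝ a b) (inner ℝ a c) (inner ℝ a d) (inner ℝ b c) (inner ℝ b d)
        (inner ℝ c d) := by
  have haa : inner ℝ a a = 1 := by simp [ha]
  have hbb : inner ℝ b b = 1 := by simp [hb]
  have hba : inner ℝ b a = inner ℝ a b := real_inner_comm _ _
  set k := inner ℝ a b with hkdef
  have proj : ∀ v : E, (Submodule.span ℝ {a, b})ᗮ.starProjection v =
      v - ((inner ℝ a v - k * inner ℝ b v) / (1 - k ^ 2)) • a
        - ((inner ℝ b v - k * inner ℝ a v) / (1 - k ^ 2)) • b := by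
    intro v
    refine Submodule.eq_starProjection_of_mem_orthogonal ?_ ?_
    · rw [Submodule.mem_orthogonal]
      intro u hu
      obtain ⟨s, t, rfl⟩ := Submodule.mem_span_pair.1 hu
      simp only [inner_add_left, inner_sub_right, inner_smul_left, inner_smul_right, haa, hbb,
        hba, ← hkdef, RCLike.conj_to_real]
      field_simp
      ring
    · refine Submodule.le_orthogonal_orthogonal _ (Submodule.mem_span_pair.2
        ⟨(inner ℝ a v - k * inner ℝ b v) / (1 - k ^ 2),
          (inner ℝ b v - k * inner ℝ a v) / (1 - k ^ 2), ?_⟩)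
      abel
  rw [proj c, proj d, dihedralInner]
  simp only [inner_sub_left, inner_sub_right, inner_smul_left, inner_smul_right, haa, hbb, hba,
    ← hkdef, RCLike.conj_to_real, real_inner_comm c a, real_inner_comm c b]
  field_simp
  ring

theorem cos_dihedralAngleOfPoints (a b c d : S3) (hk : 1 - inner ℝ (a : E4) (b : E4) ^ 2 ≠ 0) :
    Real.cos (ThreeManifoldTriangulation.dihedralAngleOfPoints a b c d) *
      (√(dihedralInner (inner ℝ (a : E4) b) (inner ℝ (a : E4) c) (inner ℝ (a : E4) c)
        (inner ℝ (b : E4) c) (inner ℝ (b : E4) c) 1) *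
      √(dihedralInner (inner ℝ (a : E4) b) (inner ℝ (a : E4) d) (inner ℝ (a : E4) d)
        (inner ℝ (b : E4) d) (inner ℝ (b : E4) d) 1)) =
      dihedralInner (inner ℝ (a : E4) b) (inner ℝ (a : E4) c) (inner ℝ (a : E4) d)
        (inner ℝ (b : E4) c) (inner ℝ (b : E4) d) (inner ℝ (c : E4) d) := by
  have unit : ∀ v : S3, ‖(v : E4)‖ = 1 := norm_eq_of_mem_sphere
  have h := inner_starProjection_orthogonal_span_pair (c : E4) (d : E4) (unit a) (unit b) hk
  have hc := inner_starProjection_orthogonal_span_pair (c : E4) (c : E4) (unit a) (unit b) hk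
  have hd := inner_starProjection_orthogonal_span_pair (d : E4) (d : E4) (unit a) (unit b) hk
  rw [real_inner_self_eq_norm_sq (c : E4), unit, one_pow] at hc
  rw [real_inner_self_eq_norm_sq (d : E4), unit, one_pow] at hd
  rw [← h, ← hc, ← hd, ← norm_eq_sqrt_real_inner, ← norm_eq_sqrt_real_inner]
  exact InnerProductGeometry.cos_angle_mul_norm_mul_norm _ _

/-- Each quantity is a ratio of Gram minors by Schur complementation. The last is the determinant of
order four over `1 - k ^ 2`: strict Cauchy–Schwarz for the two projections, which excludes the
dihedral angles 0 and π. -/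
theorem dihedralInner_pos_of_posDef {k ac ad bc bd cd : ℝ}
    (h : (!![1, k, ac, ad; k, 1, bc, bd; ac, bc, 1, cd; ad, bd, cd, 1] :
      Matrix (Fin 4) (Fin 4) ℝ).PosDef) :
    0 < 1 - k ^ 2 ∧ 0 < dihedralInner k ac ac bc bc 1 ∧ 0 < dihedralInner k ad ad bd bd 1 ∧
      dihedralInner k ac ad bc bd cd ^ 2 <
        dihedralInner k ac ac bc bc 1 * dihedralInner k ad ad bd bd 1 := by
  have d4 := h.det_pos
  have d2 := (h.submatrix (e := ![(0 : Fin 4), 1]) (by decide)).det_pos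
  have d3 := (h.submatrix (e := ![(0 : Fin 4), 1, 2]) (by decide)).det_pos
  have d3' := (h.submatrix (e := ![(0 : Fin 4), 1, 3]) (by decide)).det_pos
  rw [det_fin_four_symmetric] at d4
  rw [det_fin_two] at d2
  rw [det_fin_three] at d3 d3'
  simp at d2 d3 d3'
  have hk : 0 < 1 - k ^ 2 := by nlinarith
  have e1 : dihedralInner k ac ac bc bc 1 =
      (1 + 2 * k * ac * bc - k ^ 2 - ac ^ 2 - bc ^ 2) / (1 - k ^ 2) := by
    rw [dihedralInner]
    field_simp
    ring
  have e2 : dihedralInner k ad ad bd bd 1 =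
      (1 + 2 * k * ad * bd - k ^ 2 - ad ^ 2 - bd ^ 2) / (1 - k ^ 2) := by
    rw [dihedralInner]
    field_simp
    ring
  refine ⟨hk, ?_, ?_, ?_⟩
  · rw [e1]
    exact div_pos (by nlinarith) hk
  · rw [e2]
    exact div_pos (by nlinarith) hk
  · rw [← sub_pos]
    have e3 : dihedralInner k ac ac bc bc 1 * dihedralInner k ad ad bd bd 1 -
        dihedralInner k ac ad bc bd cd ^ 2 = (1 ^ 4 - 1 ^ 2 * (k ^ 2 + ac ^ 2 + ad ^ 2 + bc ^ 2 +
          bd ^ 2 + cd ^ 2) + 2 * 1 * (k * ac * bc + k * ad * bd + ac * ad * cd + bc * bd * cd)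
          + k ^ 2 * cd ^ 2 + ac ^ 2 * bd ^ 2 + ad ^ 2 * bc ^ 2
          - 2 * (k * ac * bd * cd + k * ad * bc * cd + ac * ad * bc * bd)) / (1 - k ^ 2) := by
      simp only [dihedralInner]
      field_simp
      ring
    rw [e3]
    exact div_pos d4 hk

namespace ThreeManifoldTriangulation

/-! ### Dihedral angles in terms of edge lengths -/

section Realizations

variable {V : Type*} [DecidableEq V] {l : Finset V → ℝ}

/-- `dihedralInner` as a function of the edge lengths. -/
def labelInner (l : Finset V → ℝ) (a b c d : V) : ℝ :=
  dihedralInner (Real.cos (l {a, b})) (Real.cos (l {a, c})) (Real.cos (l {a, d}))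
    (Real.cos (l {b, c})) (Real.cos (l {b, d})) (if c = d then 1 else Real.cos (l {c, d}))

theorem labelInner_comm_left (a b c d : V) : labelInner l b a c d = labelInner l a b c d := by
  rw [labelInner, labelInner, Finset.pair_comm b a, dihedralInner, dihedralInner]
  ring

theorem labelInner_comm_right (a b c d : V) : labelInner l a b d c = labelInner l a b c d := by
  rw [labelInner, labelInner, Finset.pair_comm d c, dihedralInner, dihedralInner]
  simp only [eq_comm (a := d)]
  ring

theorem gramMatrix_vec (a b c d : V) :
    gramMatrix l ![a, b, c, d] = !![1, Real.cos (l {a, b}), Real.cos (l {a, c}),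
      Real.cos (l {a, d}); Real.cos (l {a, b}), 1, Real.cos (l {b, c}), Real.cos (l {b, d});
      Real.cos (l {a, c}), Real.cos (l {b, c}), 1, Real.cos (l {c, d});
      Real.cos (l {a, d}), Real.cos (l {b, d}), Real.cos (l {c, d}), 1] := by
  ext i j
  fin_cases i <;> fin_cases j <;> simp [gramMatrix, Finset.pair_comm b a, Finset.pair_comm c a,
    Finset.pair_comm d a, Finset.pair_comm c b, Finset.pair_comm d b, Finset.pair_comm d c]

theorem labelInner_pos_of_posDef {a b c d : V} (hinj : Function.Injective ![a, b, c, d])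
    (h : (gramMatrix l ![a, b, c, d]).PosDef) :
    0 < 1 - Real.cos (l {a, b}) ^ 2 ∧ 0 < labelInner l a b c c ∧ 0 < labelInner l a b d d ∧
      labelInner l a b c d ^ 2 < labelInner l a b c c * labelInner l a b d d := by
  have hcd : c ≠ d := hinj.ne (show (2 : Fin 4) ≠ 3 by decide)
  rw [gramMatrix_vec] at h
  simpa [labelInner, hcd] using dihedralInner_pos_of_posDef h

theorem IsRealization.inner_eq {τ : Finset V} {P : V → S3} (h : IsRealization l τ P) {v w : V}
    (hv : v ∈ τ) (hw : w ∈ τ) (hvw : v ≠ w) :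
    inner ℝ (P v : E4) (P w : E4) = Real.cos (l {v, w}) := by
  rw [← h.2 v hv w hw hvw]
  exact InnerProductGeometry.inner_eq_cos_angle_of_norm_eq_one (norm_eq_of_mem_sphere _)
    (norm_eq_of_mem_sphere _)

theorem eq_or_eq_of_pair_eq {a b a' b' : V} (h : ({a, b} : Finset V) = {a', b'}) :
    (a' = a ∧ b' = b) ∨ (a' = b ∧ b' = a) := by
  have := congrArg (fun s : Finset V => (s : Set V)) h
  simp only [Finset.coe_insert, Finset.coe_singleton] at this
  rcases Set.pair_eq_pair_iff.1 this with ⟨h1, h2⟩ | ⟨h1, h2⟩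
  · exact Or.inl ⟨h1.symm, h2.symm⟩
  · exact Or.inr ⟨h2.symm, h1.symm⟩

theorem IsOrdering.sdiff_pair {τ : Finset V} {a b c d : V} (hx : IsOrdering ![a, b, c, d] τ) :
    τ \ {a, b} = {c, d} := by
  have ne : ∀ i j, i ≠ j → ![a, b, c, d] i ≠ ![a, b, c, d] j := fun i j => hx.1.ne
  have h02 : a ≠ c := ne 0 2 (by decide)
  have h03 : a ≠ d := ne 0 3 (by decide)
  have h12 : b ≠ c := ne 1 2 (by decide)
  have h13 : b ≠ d := ne 1 3 (by decide)
  rw [hx.vec_eq]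
  ext v
  simp only [Finset.mem_sdiff, Finset.mem_insert, Finset.mem_singleton]
  grind

/-- The cosine law expresses the cosine through `l` alone, so neither the realization nor the
ordering matters. The sine is positive because the tetrahedron is non-degenerate. -/
theorem IsInteriorDihedralAngle.spec {τ : Finset V} {a b c d : V} {θ : ℝ}
    (hx : IsOrdering ![a, b, c, d] τ) (hM : (gramMatrix l ![a, b, c, d]).PosDef)
    (h : IsInteriorDihedralAngle l {a, b} τ θ) :
    Real.cos θ * (√(labelInner l a b c c) * √(labelInner l a b d d)) = labelInner l a b c d ∧
      0 < Real.sin θ := by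
  obtain ⟨hk, hc, hd, hcd⟩ := labelInner_pos_of_posDef hx.1 hM
  obtain ⟨a', b', c', d', P, he, hx', hP, hθ⟩ := h
  have key : Real.cos θ * (√(labelInner l a' b' c' c') * √(labelInner l a' b' d' d')) =
      labelInner l a' b' c' d' := by
    have ne : ∀ i j, i ≠ j → ![a', b', c', d'] i ≠ ![a', b', c', d'] j := fun i j => hx'.1.ne
    have hin := fun i j (hij : i ≠ j) => hP.inner_eq (hx'.mem i) (hx'.mem j) (ne i j hij)
    have hab : inner ℝ (P a' : E4) (P b' : E4) = Real.cos (l {a, b}) := by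
      rw [he]
      exact hin 0 1 (by decide)
    have := cos_dihedralAngleOfPoints (P a') (P b') (P c') (P d') (by rw [hab]; exact hk.ne')
    rw [← hθ] at this
    have h01 := hin 0 1 (by decide)
    have h02 := hin 0 2 (by decide)
    have h03 := hin 0 3 (by decide)
    have h12 := hin 1 2 (by decide)
    have h13 := hin 1 3 (by decide)
    have h23 := hin 2 3 (by decide)
    have n23 := ne 2 3 (by decide)
    simp at h01 h02 h03 h12 h13 h23 n23
    rw [h01, h02, h03, h12, h13, h23] at this
    simpa [labelInner, n23] using this
  have key' : Real.cos θ * (√(labelInner l a b c c) * √(labelInner l a b d d)) =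
      labelInner l a b c d := by
    have hsub : ({c', d'} : Finset V) = {c, d} := by
      rw [← hx'.sdiff_pair, ← hx.sdiff_pair, he]
    -- The edge and its opposite edge being fixed, only swaps within each pair remain, and
    -- `labelInner` is invariant under both.
    rcases eq_or_eq_of_pair_eq he with ⟨rfl, rfl⟩ | ⟨rfl, rfl⟩ <;>
    rcases eq_or_eq_of_pair_eq hsub with ⟨rfl, rfl⟩ | ⟨rfl, rfl⟩
    · exact key
    · rwa [labelInner_comm_right _ _ d c, mul_comm (√(labelInner l _ _ c c))]
    · simpa only [labelInner_comm_left a' b'] using key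
    · rw [labelInner_comm_right _ _ d c, mul_comm (√(labelInner l _ _ c c))]
      simpa only [labelInner_comm_left a' b'] using key
  refine ⟨key', lt_of_le_of_ne (Real.sin_nonneg_of_nonneg_of_le_pi ?_ ?_) fun h0 => ?_⟩
  · rw [hθ]
    exact InnerProductGeometry.angle_nonneg _ _
  · rw [hθ]
    exact InnerProductGeometry.angle_le_pi _ _
  · have hcos : Real.cos θ ^ 2 = 1 := by
      have := Real.sin_sq_add_cos_sq θ
      rw [← h0] at this
      linarith
    rw [← key', mul_pow, hcos, mul_pow, Real.sq_sqrt hc.le, Real.sq_sqrt hd.le] at hcd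
    linarith

theorem linearIndependent_of_frame {P : V → E4} {τ : Finset V} {x : Fin 4 → V} (hx : IsOrdering x τ)
    (h : (frame (fun v => (P v).ofLp) x).det ≠ 0) :
    LinearIndependent ℝ fun v : τ => P v := by
  have h1 : LinearIndependent ℝ fun i => (P (x i)).ofLp := linearIndependent_rows_of_det_ne_zero h
  have h2 : LinearIndependent ℝ fun i => P (x i) :=
    LinearIndependent.of_comp (WithLp.linearEquiv 2 ℝ (Fin 4 → ℝ)).toLinearMap h1
  let e : Fin 4 ≃ τ := Equiv.ofBijective (fun i => ⟨x i, hx.mem i⟩)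
    ⟨fun i j hij => hx.1 (congrArg Subtype.val hij), fun v => by
      obtain ⟨i, hi⟩ := hx.exists_eq v.2
      exact ⟨i, Subtype.ext hi⟩⟩
  exact (linearIndependent_equiv e).1 h2

end Realizations

variable {Y : Type*} [TopologicalSpace Y] {V : Type*} [Fintype V] [DecidableEq V]
variable {T : ThreeManifoldTriangulation Y V} {o : T.Orientation} {l : Finset V → ℝ}
  {s : Finset V → ℤˣ} {p q : V → Fin 4 → ℝ} {σ τ : Finset V} {x : Fin 4 → V}

/-- Points of the sphere with the coordinates `p v`, where these have norm one. -/
def toSphere (p : V → Fin 4 → ℝ) (v : V) : S3 := by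
  classical
  exact if h : ‖WithLp.toLp 2 (p v)‖ = 1 then ⟨WithLp.toLp 2 (p v), by simpa using h⟩
    else ⟨EuclideanSpace.single 0 1, by simp⟩

theorem IsOrientedFrame.dotProduct_eq (h : IsOrientedFrame o l s p τ x) (i j : Fin 4) :
    p (x i) ⬝ᵥ p (x j) = if i = j then 1 else Real.cos (l {x i, x j}) :=
  congrFun (congrFun h.1 i) j

theorem IsOrientedFrame.coe_toSphere (h : IsOrientedFrame o l s p τ x) (hx : IsOrdering x τ)
    {v : V} (hv : v ∈ τ) : (toSphere p v : E4) = WithLp.toLp 2 (p v) := by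
  obtain ⟨i, rfl⟩ := hx.exists_eq hv
  have h1 : ‖WithLp.toLp 2 (p (x i))‖ = 1 := by
    have := h.dotProduct_eq i i
    rw [EuclideanSpace.norm_eq, Real.sqrt_eq_one]
    simpa [dotProduct, sq] using this
  simp [toSphere, h1]

theorem label_mem_Icc (hl : T.IsLabelling l) (hτ : τ ∈ T.Tet) {v w : V} (hv : v ∈ τ) (hw : w ∈ τ)
    (hvw : v ≠ w) : l {v, w} ∈ Set.Icc 0 Real.pi :=
  hl.mem_Icc _ ⟨PreAbstractSimplicialComplex.mem_of_subset_of_mem hτ.1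
    (by simp [Finset.insert_subset_iff, hv, hw]) (by simp), Finset.card_pair hvw⟩

theorem IsOrientedFrame.isRealization (h : IsOrientedFrame o l s p τ x) (hl : T.IsLabelling l)
    (hτ : τ ∈ T.Tet) (hx : IsOrdering x τ) : IsRealization l τ (toSphere p) := by
  refine ⟨linearIndependent_of_frame (P := fun v => (toSphere p v : E4)) hx ?_, ?_⟩
  · have : frame (fun v => (toSphere p v : E4).ofLp) x = frame p x := by
      ext i j
      simp [frame, h.coe_toSphere hx (hx.mem i)]
    rw [this]
    exact h.det_ne_zero
  · intro v hv w hw hvw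
    have hmem := label_mem_Icc hl hτ hv hw hvw
    obtain ⟨i, rfl⟩ := hx.exists_eq hv
    obtain ⟨j, rfl⟩ := hx.exists_eq hw
    have hij : i ≠ j := fun hij => hvw (by rw [hij])
    have hin : inner ℝ (toSphere p (x i) : E4) (toSphere p (x j) : E4) =
        Real.cos (l {x i, x j}) := by
      rw [h.coe_toSphere hx hv, h.coe_toSphere hx hw, EuclideanSpace.inner_toLp_toLp,
        star_trivial, dotProduct_comm, h.dotProduct_eq, if_neg hij]
    rw [InnerProductGeometry.angle, hin, norm_eq_of_mem_sphere, norm_eq_of_mem_sphere, mul_one,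
      div_one, Real.arccos_cos hmem.1 hmem.2]

theorem IsRealization.isOrientedFrame {P : V → S3} (h : IsRealization l τ P)
    (hx : IsOrdering x τ) (hdet : 0 < (((s τ * o.sign x : ℤˣ) : ℤ) : ℝ) *
      (Matrix.of fun i j : Fin 4 => (P (x i) : E4) j).det) :
    IsOrientedFrame o l s (fun v => (P v : E4).ofLp) τ x := by
  refine ⟨?_, hdet⟩
  ext i j
  have h1 : (frame (fun v => (P v : E4).ofLp) x * (frame (fun v => (P v : E4).ofLp) x)ᵀ) i j =
      inner ℝ (P (x i) : E4) (P (x j) : E4) := by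
    rw [EuclideanSpace.inner_eq_star_dotProduct, star_trivial, dotProduct_comm]
    rfl
  rw [h1, gramMatrix, Matrix.of_apply]
  split_ifs with hij
  · rw [hij, real_inner_self_eq_norm_sq, norm_eq_of_mem_sphere, one_pow]
  · exact h.inner_eq (hx.mem i) (hx.mem j) (hx.1.ne hij)

theorem interiorDihedralAngle_spec (hl : T.IsLabelling l) (o : T.Orientation) {a b c d : V}
    (hτ : τ ∈ T.Tet) (hx : IsOrdering ![a, b, c, d] τ) :
    Real.cos (interiorDihedralAngle l {a, b} τ) *
      (√(labelInner l a b c c) * √(labelInner l a b d d)) = labelInner l a b c d ∧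
      0 < Real.sin (interiorDihedralAngle l {a, b} τ) := by
  obtain ⟨hM, p, hp⟩ := exists_isOrientedFrame hl o (fun _ => 1) hτ hx
  have hex : ∃ θ, IsInteriorDihedralAngle l {a, b} τ θ :=
    ⟨_, a, b, c, d, toSphere p, rfl, hx, hp.isRealization hl hτ hx, rfl⟩
  have hspec : IsInteriorDihedralAngle l {a, b} τ (interiorDihedralAngle l {a, b} τ) := by
    rw [interiorDihedralAngle, dif_pos hex]
    exact hex.choose_spec
  exact hspec.spec hx hM

end ThreeManifoldTriangulation

end

noncomputable section

/-! ### Developments around an edge -/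

/-- A function with vanishing total sum along a cyclic permutation is a difference. -/
theorem Equiv.Perm.exists_sub_eq_of_sum_eq_zero {α A : Type*} [Fintype α] [AddCommGroup A]
    (π : Equiv.Perm α) (hπ : ∀ x y, π.SameCycle x y) (f : α → A) (hf : ∑ x, f x = 0) :
    ∃ θ : α → A, ∀ x, θ (π x) = θ x + f x := by
  classical
  obtain hE | ⟨⟨x₀⟩⟩ := isEmpty_or_nonempty α
  · exact ⟨0, fun x => hE.elim x⟩
  have hc : π.IsCycleOn ((Finset.univ : Finset α) : Set α) :=
    ⟨by simp [Set.bijOn_univ], fun x _ y _ => hπ x y⟩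
  set N := (Finset.univ : Finset α).card with hN
  have hex : ∀ x, ∃ n < N, (π ^ n) x₀ = x := fun x =>
    hc.exists_pow_eq (Finset.mem_univ x₀) (Finset.mem_univ x)
  choose k hk hk' using hex
  -- Partial sums along the orbit of `x₀`; the primitive at `x` is the sum accumulated before
  -- reaching `x`. Vanishing of the total makes it consistent where the orbit closes.
  let F : ℕ → A := fun n => ∑ i ∈ Finset.range n, f ((π ^ i) x₀)
  have huniq : ∀ n < N, k ((π ^ n) x₀) = n := fun n hn =>
    Nat.ModEq.eq_of_lt_of_lt ((hc.pow_apply_eq_pow_apply (Finset.mem_univ x₀)).1 (hk' _))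
      (hk _) hn
  have hFN : F N = 0 := by
    rw [← hf]
    refine Finset.sum_bij' (fun i _ => (π ^ i) x₀) (fun x _ => k x) ?_ ?_ ?_ ?_ ?_
    · simp
    · intro x _
      simpa using hk x
    · intro i hi
      exact huniq i (Finset.mem_range.1 hi)
    · intro x _
      exact hk' x
    · simp
  refine ⟨fun x => F (k x), fun x => ?_⟩
  have hstep : F (k x + 1) = F (k x) + f x := by
    simp only [F, Finset.sum_range_succ, hk']
  have hπx : (π ^ (k x + 1)) x₀ = π x := by
    rw [pow_succ', Equiv.Perm.mul_apply, hk']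
  rcases (Nat.succ_le_of_lt (hk x)).lt_or_eq with h | h
  · dsimp only
    rw [← hstep, ← hπx]
    exact congrArg F (huniq _ h)
  · have hx₀ : π x = x₀ := by
      rw [← hπx]
      have : k x + 1 = N := h
      rw [this]
      exact hc.pow_card_apply (Finset.mem_univ x₀)
    have h0 : k x₀ = 0 := huniq 0 (by omega)
    have : F (k x + 1) = 0 := by
      rw [← hFN]
      exact congrArg F h
    rw [hstep] at this
    dsimp only
    rw [hx₀, h0, this]
    simp [F]

namespace ThreeManifoldTriangulation

theorem insert_insert_pair {V : Type*} [DecidableEq V] (a b c d : V) :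
    (insert d (insert c {a, b}) : Finset V) = {a, b, c, d} := by
  ext v
  simp only [Finset.mem_insert, Finset.mem_singleton]
  tauto

variable {Y : Type*} [TopologicalSpace Y] {V : Type*} [Fintype V] [DecidableEq V]
variable {T : ThreeManifoldTriangulation Y V} {o : T.Orientation} {l : Finset V → ℝ}
  {s : Finset V → ℤˣ} {σ τ : Finset V}

/-- The link of a triangle is the two-point sphere, and by the dimension bound all its points are
vertices. -/
theorem exists_two_tets {σ : Finset V} (hσ : σ ∈ T.complex) (hcard : σ.card = 3) :
    ∃ d d', d ≠ d' ∧ insert d σ ∈ T.Tet ∧ insert d' σ ∈ T.Tet := by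
  obtain ⟨-, ⟨e⟩⟩ := T.isClosedThreeManifold σ hσ
  have hn : 4 - σ.card = 1 := by omega
  rw [hn] at e
  have vertex : ∀ x : (T.complex.link σ).realization, ∃ d, insert d σ ∈ T.Tet ∧
      x.1 = Pi.single d 1 := by
    rintro ⟨x, hx, ρ, hρ, hsupp⟩
    have hρ4 := (T.isClosedThreeManifold _ hρ.2.2).1
    rw [Finset.card_union_of_disjoint hρ.2.1] at hρ4
    have hρ1 : ρ.card = 1 := by
      have := hρ.1.card_pos
      omega
    obtain ⟨d, rfl⟩ := Finset.card_eq_one.1 hρ1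
    have hd := mem_link_singleton.1 hρ
    refine ⟨d, ⟨hd.2, by rw [Finset.card_insert_of_notMem hd.1, hcard]⟩, ?_⟩
    have hzero : ∀ v ≠ d, x v = 0 := fun v hv => by
      by_contra h
      exact hv (by simpa using hsupp v h)
    have hone : x d = 1 := by
      rw [← hx.2, Finset.sum_eq_single d (fun v _ hv => hzero v hv) (by simp)]
    ext v
    by_cases hv : v = d
    · subst hv; simp [hone]
    · simp [hv, hzero v hv]
  let u : Metric.sphere (0 : EuclideanSpace ℝ (Fin 1)) 1 :=
    ⟨EuclideanSpace.single 0 1, by simp⟩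
  obtain ⟨d, hd, hxd⟩ := vertex (e.symm u)
  obtain ⟨d', hd', hxd'⟩ := vertex (e.symm (-u))
  refine ⟨d, d', ?_, hd, hd'⟩
  rintro rfl
  have h1 := e.symm.injective (Subtype.ext (hxd.trans hxd'.symm))
  have h2 := congrArg (fun w : Metric.sphere (0 : EuclideanSpace ℝ (Fin 1)) 1 =>
    (w : EuclideanSpace ℝ (Fin 1)) 0) h1
  have h3 : (1 : ℝ) = -1 := by simpa [u] using h2
  norm_num at h3

theorem Orientation.sign_swap (o : T.Orientation) {a b c d : V}
    (hx : IsOrdering ![a, b, c, d] τ) (hτ : τ ∈ T.Tet) :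
    o.sign ![a, b, d, c] = -o.sign ![a, b, c, d] := by
  have h := o.sign_perm τ hτ _ hx (Equiv.swap 2 3)
  have hcomp : ![a, b, c, d] ∘ Equiv.swap (2 : Fin 4) 3 = ![a, b, d, c] := by
    ext i
    fin_cases i <;> simp [Equiv.swap_apply_def]
  rw [hcomp, Equiv.Perm.sign_swap (by decide)] at h
  simpa using h

/-! ### The cyclic order of tetrahedra around an edge -/

section Edge

variable {a b : V}

/-- The vertices of the link of the edge `ab`. -/
abbrev EdgeLink (T : ThreeManifoldTriangulation Y V) (a b : V) : Type _ :=
  {c : V // c ∉ ({a, b} : Finset V) ∧ insert c {a, b} ∈ T.complex}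

/-- `d` follows `c` in the positive sense around the edge `ab`. -/
def IsNext (o : T.Orientation) (a b c d : V) : Prop :=
  ({a, b, c, d} : Finset V) ∈ T.Tet ∧ o.sign ![a, b, c, d] = 1

theorem isNext_or_isNext {c d : V} (h : ({a, b, c, d} : Finset V) ∈ T.Tet) :
    IsNext o a b c d ∨ IsNext o a b d c := by
  rcases Int.units_eq_one_or (o.sign ![a, b, c, d]) with h1 | h1
  · exact Or.inl ⟨h, h1⟩
  · refine Or.inr ⟨?_, ?_⟩
    · rwa [Finset.pair_comm d c]
    · rw [o.sign_swap (isOrdering_vec h.2) h, h1, neg_neg]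

theorem IsNext.right_unique {c d d' : V} (h : IsNext o a b c d) (h' : IsNext o a b c d') :
    d = d' := by
  by_contra hne
  have := o.coherent _ h.1 _ h'.1 a b c d d' hne (isOrdering_vec h.1.2) (isOrdering_vec h'.1.2)
  rw [h.2, h'.2] at this
  exact absurd this (by decide)

theorem IsNext.left_unique {c c' d : V} (h : IsNext o a b c d) (h' : IsNext o a b c' d) :
    c = c' := by
  by_contra hne
  have t1 : ({a, b, d, c} : Finset V) ∈ T.Tet := by
    rw [Finset.pair_comm d c]
    exact h.1
  have t2 : ({a, b, d, c'} : Finset V) ∈ T.Tet := by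
    rw [Finset.pair_comm d c']
    exact h'.1
  have := o.coherent _ t1 _ t2 a b d c c' hne (isOrdering_vec t1.2) (isOrdering_vec t2.2)
  rw [o.sign_swap (isOrdering_vec h.1.2) h.1, o.sign_swap (isOrdering_vec h'.1.2) h'.1, h.2,
    h'.2] at this
  exact absurd this (by decide)

theorem IsNext.asymm {c d : V} (h : IsNext o a b c d) : ¬IsNext o a b d c := fun h' => by
  have := o.sign_swap (isOrdering_vec h.1.2) h.1
  rw [h.2, h'.2] at this
  exact absurd this (by decide)

theorem mem_edgeLink_of_tet {c d : V} (h : ({a, b, c, d} : Finset V) ∈ T.Tet) :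
    c ∉ ({a, b} : Finset V) ∧ insert c {a, b} ∈ T.complex := by
  have hinj := (isOrdering_vec h.2).1
  have h02 : a ≠ c := hinj.ne (show (0 : Fin 4) ≠ 2 by decide)
  have h12 : b ≠ c := hinj.ne (show (1 : Fin 4) ≠ 2 by decide)
  refine ⟨by simp [h02.symm, h12.symm],
    PreAbstractSimplicialComplex.mem_of_subset_of_mem h.1 ?_ (by simp)⟩
  simp [Finset.insert_subset_iff]

/-- Of the two tetrahedra on the triangle `abc`, coherence of the orientation makes one positive as
an ordered tetrahedron starting with `a`, `b`, `c`. -/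
theorem exists_isNext (hab : a ≠ b) (c : EdgeLink T a b) :
    ∃ d : EdgeLink T a b, IsNext o a b c.1 d.1 := by
  have hcard : (insert c.1 {a, b} : Finset V).card = 3 := by
    rw [Finset.card_insert_of_notMem c.2.1, Finset.card_pair hab]
  obtain ⟨d, d', hne, hd, hd'⟩ := exists_two_tets c.2.2 hcard
  rw [insert_insert_pair] at hd hd'
  have lift : ∀ e, IsNext o a b c.1 e → ∃ d : EdgeLink T a b, IsNext o a b c.1 d.1 := fun e he =>
    ⟨⟨e, mem_edgeLink_of_tet (d := c.1) (by rw [Finset.pair_comm e]; exact he.1)⟩, he⟩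
  rcases Int.units_eq_one_or (o.sign ![a, b, c.1, d]) with h1 | h1
  · exact lift d ⟨hd, h1⟩
  · refine lift d' ⟨hd', ?_⟩
    rw [o.coherent _ hd _ hd' a b c.1 d d' hne (isOrdering_vec hd.2) (isOrdering_vec hd'.2), h1,
      neg_neg]

theorem exists_next_perm (o : T.Orientation) (hab : a ≠ b) :
    ∃ π : Equiv.Perm (EdgeLink T a b), ∀ c, IsNext o a b c.1 (π c).1 := by
  choose n hn using fun c : EdgeLink T a b => exists_isNext (o := o) hab c
  have hinj : Function.Injective n := fun c c' h =>
    Subtype.ext ((hn c).left_unique (h ▸ hn c'))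
  exact ⟨Equiv.ofBijective n (Finite.injective_iff_bijective.1 hinj), hn⟩

/-- Adjacent vertices of the link follow one another in one of the two directions, so the cycle of
`c` is constant along edges and fills the connected link. -/
theorem sameCycle_of_isNext [PreconnectedSpace (T.complex.link {a, b}).realization] (hab : a ≠ b)
    {π : Equiv.Perm (EdgeLink T a b)} (hπ : ∀ c, IsNext o a b c.1 (π c).1)
    (c d : EdgeLink T a b) : π.SameCycle c d := by
  let f : V → Prop := fun v => ∃ hv, π.SameCycle c ⟨v, hv⟩
  have hadj : ∀ v w, {v, w} ∈ T.complex.link {a, b} → f v = f w := by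
    have step : ∀ v w, IsNext o a b v w → f v = f w := by
      intro v w h
      have hv := mem_edgeLink_of_tet h.1
      have hw : π ⟨v, hv⟩ = ⟨w, mem_edgeLink_of_tet (d := v)
          (by rw [Finset.pair_comm w]; exact h.1)⟩ := Subtype.ext ((hπ ⟨v, hv⟩).right_unique h)
      refine propext ⟨fun ⟨h1, h2⟩ => ⟨_, hw ▸ Equiv.Perm.sameCycle_apply_right.2 h2⟩,
        fun ⟨h1, h2⟩ => ⟨hv, ?_⟩⟩
      rw [← Equiv.Perm.sameCycle_apply_right, hw]
      exact h2
    intro v w hvw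
    by_cases hne : v = w
    · rw [hne]
    · have h1 := insert_insert_mem hvw
      have hd := hvw.2.1
      have htet : ({a, b, w, v} : Finset V) ∈ T.Tet := by
        rw [← insert_insert_pair]
        refine ⟨h1, ?_⟩
        have := Finset.card_union_of_disjoint hd
        rw [Finset.card_pair hne, Finset.card_pair hab, Finset.insert_union,
          Finset.singleton_union] at this
        exact this
      rcases isNext_or_isNext (o := o) htet with h | h
      · exact (step _ _ h).symm
      · exact step _ _ h
  have h := PreAbstractSimplicialComplex.eq_of_preconnectedSpace f hadj
    (mem_link_singleton.2 c.2) (mem_link_singleton.2 d.2)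
  have hc : f c.1 := ⟨c.2, Equiv.Perm.SameCycle.refl _ _⟩
  rw [h] at hc
  exact hc.2

theorem exists_isNext_of_tet (o : T.Orientation) (hab : a ≠ b) (hτ : τ ∈ T.Tet)
    (hsub : {a, b} ⊆ τ) : ∃ c d, IsNext o a b c d ∧ τ = {a, b, c, d} := by
  have hcard : (τ \ {a, b}).card = 2 := by
    have := Finset.card_sdiff_add_card_eq_card hsub
    rw [hτ.2, Finset.card_pair hab] at this
    omega
  obtain ⟨c, d, -, hcd⟩ := Finset.card_eq_two.1 hcard
  have hτ' : τ = {a, b, c, d} := by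
    rw [← Finset.union_sdiff_of_subset hsub, hcd, Finset.insert_union, Finset.singleton_union]
  rcases isNext_or_isNext (o := o) (hτ' ▸ hτ) with h | h
  · exact ⟨c, d, h, hτ'⟩
  · exact ⟨d, c, h, by rw [hτ', Finset.pair_comm c d]⟩

-- Turns the sum over the cycle into the sum defining the defect angle: each tetrahedron around `ab`
-- arises from exactly one `c`, since `IsNext` is asymmetric.
open Classical in
theorem sum_edgeLink (hab : a ≠ b) {π : Equiv.Perm (EdgeLink T a b)}
    (hπ : ∀ c, IsNext o a b c.1 (π c).1) (F : Finset V → ℝ) :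
    ∑ c : EdgeLink T a b, F {a, b, c.1, (π c).1} =
      ∑ τ : Finset V with τ ∈ T.Tet ∧ {a, b} ⊆ τ, F τ := by
  refine Finset.sum_bij (fun c _ => {a, b, c.1, (π c).1}) ?_ ?_ ?_ ?_
  · intro c _
    simp [(hπ c).1, Finset.insert_subset_iff]
  · intro c _ c' _ h
    have h1 := (isOrdering_vec (hπ c).1.2).sdiff_pair
    have h2 := (isOrdering_vec (hπ c').1.2).sdiff_pair
    rw [h, h2] at h1
    rcases eq_or_eq_of_pair_eq h1 with ⟨h3, -⟩ | ⟨h3, h4⟩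
    · exact Subtype.ext h3
    · exact absurd (h4 ▸ h3 ▸ hπ c) (hπ c').asymm
  · intro τ hτ
    obtain ⟨hτ, hsub⟩ := (Finset.mem_filter.1 hτ).2
    obtain ⟨c, d, h, rfl⟩ := exists_isNext_of_tet o hab hτ hsub
    refine ⟨⟨c, mem_edgeLink_of_tet h.1⟩, Finset.mem_univ _, ?_⟩
    rw [(hπ ⟨c, mem_edgeLink_of_tet h.1⟩).right_unique h]
  · simp

/-- The points with the prescribed distances to the points `(1, 0, 0, 0)` and `(cos l, sin l, 0, 0)`
at which `a` and `b` are placed, and with the angles `θ` in the plane orthogonal to these. -/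
def edgeDevelopment (l : Finset V → ℝ) (a b : V) (θ : V → Real.Angle) (v : V) : Fin 4 → ℝ :=
  if v = a then ![1, 0, 0, 0]
  else if v = b then ![Real.cos (l {a, b}), √(1 - Real.cos (l {a, b}) ^ 2), 0, 0]
  else ![Real.cos (l {a, v}), (Real.cos (l {b, v}) - Real.cos (l {a, b}) * Real.cos (l {a, v})) /
      √(1 - Real.cos (l {a, b}) ^ 2),
    √(labelInner l a b v v) * (θ v).cos, √(labelInner l a b v v) * (θ v).sin]

/-- Orthogonally to the edge, `c` and `d` have polar angles differing by $s\phi$. The even cosine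
gives the length of `cd` by the spherical cosine law, whatever the sign $s$, while the determinant
is a positive multiple of $\sin(s\phi)$ and so carries that sign. -/
theorem isOrientedFrame_edgeDevelopment (hl : T.IsLabelling l) {c d : V} {θ : V → Real.Angle}
    (h : IsNext o a b c d)
    (hθ : θ d = θ c + (((s {a, b, c, d} : ℤ) : ℝ) *
      interiorDihedralAngle l {a, b} {a, b, c, d} : ℝ)) :
    IsOrientedFrame o l s (edgeDevelopment l a b θ) {a, b, c, d} ![a, b, c, d] := by
  have hx := isOrdering_vec h.1.2
  have hM := (exists_isOrientedFrame hl o s h.1 hx).1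
  obtain ⟨hk, hc, hd, -⟩ := labelInner_pos_of_posDef hx.1 hM
  obtain ⟨hcos, hsin⟩ := interiorDihedralAngle_spec hl o h.1 hx
  set φ := interiorDihedralAngle l {a, b} {a, b, c, d} with hφ
  have hab : b ≠ a := hx.1.ne (show (1 : Fin 4) ≠ 0 by decide)
  have hca : c ≠ a := hx.1.ne (show (2 : Fin 4) ≠ 0 by decide)
  have hcb : c ≠ b := hx.1.ne (show (2 : Fin 4) ≠ 1 by decide)
  have hda : d ≠ a := hx.1.ne (show (3 : Fin 4) ≠ 0 by decide)
  have hdb : d ≠ b := hx.1.ne (show (3 : Fin 4) ≠ 1 by decide)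
  have hcd : c ≠ d := hx.1.ne (show (2 : Fin 4) ≠ 3 by decide)
  have hF : frame (edgeDevelopment l a b θ) ![a, b, c, d] = Matrix.of ![
      ![1, 0, 0, 0],
      ![Real.cos (l {a, b}), √(1 - Real.cos (l {a, b}) ^ 2), 0, 0],
      ![Real.cos (l {a, c}),
        (Real.cos (l {b, c}) - Real.cos (l {a, b}) * Real.cos (l {a, c})) /
          √(1 - Real.cos (l {a, b}) ^ 2),
        √(labelInner l a b c c) * (θ c).cos, √(labelInner l a b c c) * (θ c).sin],
      ![Real.cos (l {a, d}),
        (Real.cos (l {b, d}) - Real.cos (l {a, b}) * Real.cos (l {a, d})) /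
          √(1 - Real.cos (l {a, b}) ^ 2),
        √(labelInner l a b d d) * (θ d).cos, √(labelInner l a b d d) * (θ d).sin]] := by
    ext i j
    fin_cases i <;> simp [frame, edgeDevelopment, hab, hca, hcb, hda, hdb]
  have hdiff : θ d - θ c = (((s {a, b, c, d} : ℤ) : ℝ) * φ : ℝ) := by rw [hθ, add_sub_cancel_left]
  have hcosdiff : (θ c).cos * (θ d).cos + (θ c).sin * (θ d).sin = Real.cos φ := by
    have h1 : (θ d - θ c).cos = Real.cos φ := by
      rw [hdiff, Real.Angle.cos_coe]
      rcases Int.units_eq_one_or (s {a, b, c, d}) with h1 | h1 <;> simp [h1]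
    rw [sub_eq_add_neg, Real.Angle.cos_add, Real.Angle.cos_neg, Real.Angle.sin_neg] at h1
    linarith
  have hsindiff : ((s {a, b, c, d} : ℤ) : ℝ) *
      ((θ c).cos * (θ d).sin - (θ c).sin * (θ d).cos) = Real.sin φ := by
    have h1 : ((s {a, b, c, d} : ℤ) : ℝ) * (θ d - θ c).sin = Real.sin φ := by
      rw [hdiff, Real.Angle.sin_coe]
      rcases Int.units_eq_one_or (s {a, b, c, d}) with h1 | h1 <;> simp [h1]
    rw [sub_eq_add_neg, Real.Angle.sin_add, Real.Angle.cos_neg, Real.Angle.sin_neg] at h1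
    rw [← h1]
    ring
  have hS : √(1 - Real.cos (l {a, b}) ^ 2) ^ 2 = 1 - Real.cos (l {a, b}) ^ 2 := Real.sq_sqrt hk.le
  have hS0 : 0 < √(1 - Real.cos (l {a, b}) ^ 2) := Real.sqrt_pos.2 hk
  have hRc : √(labelInner l a b c c) ^ 2 = labelInner l a b c c := Real.sq_sqrt hc.le
  have hRd : √(labelInner l a b d d) ^ 2 = labelInner l a b d d := Real.sq_sqrt hd.le
  have hRc0 : 0 < √(labelInner l a b c c) := Real.sqrt_pos.2 hc
  have hRd0 : 0 < √(labelInner l a b d d) := Real.sqrt_pos.2 hd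
  refine ⟨?_, ?_⟩
  · rw [hF, gramMatrix_vec]
    set k := Real.cos (l {a, b})
    set S := √(1 - k ^ 2)
    set Rc := √(labelInner l a b c c)
    set Rd := √(labelInner l a b d d)
    have hinner : ∀ u v, u * v / (S * S) = u * v / (1 - k ^ 2) := fun u v => by rw [← sq, hS]
    have e11 : k * k + S * S = 1 := by linear_combination hS
    have e1 : ∀ u v, k * u + S * ((v - k * u) / S) = v := fun u v => by
      field_simp
      ring
    have self : ∀ v R, R ^ 2 = labelInner l a b v v → ∀ t : Real.Angle,
        Real.cos (l {a, v}) * Real.cos (l {a, v}) +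
          ((Real.cos (l {b, v}) - k * Real.cos (l {a, v})) / S *
            ((Real.cos (l {b, v}) - k * Real.cos (l {a, v})) / S) +
          (R * t.cos * (R * t.cos) + R * t.sin * (R * t.sin))) = 1 := by
      intro v R hv t
      have h1 := t.cos_sq_add_sin_sq
      have h2 : R * t.cos * (R * t.cos) + R * t.sin * (R * t.sin) = labelInner l a b v v := by
        linear_combination R ^ 2 * h1 + hv
      rw [h2, div_mul_div_comm, hinner, labelInner, dihedralInner, if_pos rfl,
        show Real.cos (l {a, b}) = k from rfl]
      field_simp
      ring
    have e23 : Real.cos (l {a, c}) * Real.cos (l {a, d}) +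
          ((Real.cos (l {b, c}) - k * Real.cos (l {a, c})) / S *
            ((Real.cos (l {b, d}) - k * Real.cos (l {a, d})) / S) +
          (Rc * (θ c).cos * (Rd * (θ d).cos) + Rc * (θ c).sin * (Rd * (θ d).sin))) =
          Real.cos (l {c, d}) := by
      have h2 : Rc * (θ c).cos * (Rd * (θ d).cos) + Rc * (θ c).sin * (Rd * (θ d).sin) =
          labelInner l a b c d := by
        linear_combination Rc * Rd * hcosdiff + hcos
      rw [h2, div_mul_div_comm, hinner, labelInner, dihedralInner, if_neg hcd,
        show Real.cos (l {a, b}) = k from rfl]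
      field_simp
      ring
    have e22 := self c Rc hRc (θ c)
    have e33 := self d Rd hRd (θ d)
    ext i j
    have e1' : ∀ u v, u * k + (v - k * u) / S * S = v := fun u v => by
      linear_combination e1 u v
    have e32 : Real.cos (l {a, d}) * Real.cos (l {a, c}) +
          ((Real.cos (l {b, d}) - k * Real.cos (l {a, d})) / S *
            ((Real.cos (l {b, c}) - k * Real.cos (l {a, c})) / S) +
          (Rd * (θ d).cos * (Rc * (θ c).cos) + Rd * (θ d).sin * (Rc * (θ c).sin))) =
          Real.cos (l {c, d}) := by
      linear_combination e23
    fin_cases i <;> fin_cases j <;>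
      simp [mul_apply, Fin.sum_univ_succ, e11, e1, e1', e22, e23, e32, e33]
  · have hdet : (frame (edgeDevelopment l a b θ) ![a, b, c, d]).det =
        √(1 - Real.cos (l {a, b}) ^ 2) * (√(labelInner l a b c c) * √(labelInner l a b d d) *
          ((θ c).cos * (θ d).sin - (θ c).sin * (θ d).cos)) := by
      rw [hF, det_succ_row_zero]
      simp [Fin.sum_univ_succ, det_fin_three, Fin.succAbove]
      ring
    rw [hdet, h.2, mul_one]
    have : 0 < √(1 - Real.cos (l {a, b}) ^ 2) * (√(labelInner l a b c c) *
      √(labelInner l a b d d)) * Real.sin φ := by positivity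
    rw [← hsindiff] at this
    linarith

/-- Flatness is the condition that the increments $s\phi$, summed once around the edge, vanish in
`Real.Angle`; this makes the polar angle a well-defined function on the link. -/
theorem exists_development_edge [PreconnectedSpace (T.complex.link {a, b}).realization]
    (o : T.Orientation) (hl : T.IsLabelling l) (hflat : T.IsFlat l s) (hab : a ≠ b)
    (he : {a, b} ∈ T.complex) : ∃ p, IsDevelopment o l s {a, b} p := by
  classical
  obtain ⟨π, hπ⟩ := exists_next_perm o hab
  let F : Finset V → ℝ := fun τ => ((s τ : ℤ) : ℝ) * interiorDihedralAngle l {a, b} τ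
  have hsum : ∑ c : EdgeLink T a b, ((F {a, b, c.1, (π c).1} : ℝ) : Real.Angle) = 0 := by
    have h1 := hflat {a, b} ⟨he, Finset.card_pair hab⟩
    have h2 := map_sum Real.Angle.coeHom (fun c : EdgeLink T a b => F {a, b, c.1, (π c).1})
      Finset.univ
    simp only [Real.Angle.coe_coeHom] at h2
    rw [← h2, sum_edgeLink hab hπ]
    rw [defectAngle, Real.Angle.coe_sub, Real.Angle.coe_two_pi, zero_sub, neg_eq_zero] at h1
    exact h1
  obtain ⟨θ, hθ⟩ := π.exists_sub_eq_of_sum_eq_zero (sameCycle_of_isNext hab hπ)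
    (fun c => ((F {a, b, c.1, (π c).1} : ℝ) : Real.Angle)) hsum
  let Θ : V → Real.Angle := fun v => if hv : _ then θ ⟨v, hv⟩ else 0
  have hΘ : ∀ c : EdgeLink T a b, Θ c.1 = θ c := fun c => dif_pos c.2
  refine ⟨edgeDevelopment l a b Θ, fun τ hτ hsub x hx => ?_⟩
  obtain ⟨c, d, h, rfl⟩ := exists_isNext_of_tet o hab hτ hsub
  refine (isOrientedFrame_edgeDevelopment hl h ?_).reorder hτ (isOrdering_vec h.1.2) hx
  have h1 := hθ ⟨c, mem_edgeLink_of_tet h.1⟩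
  rw [← hΘ, ← hΘ, (hπ ⟨c, mem_edgeLink_of_tet h.1⟩).right_unique h] at h1
  exact h1

end Edge

end ThreeManifoldTriangulation

end

noncomputable section

/-! ### The developing map -/

theorem sum_smul_coe_eq_sum_subtype {V E : Type*} [Fintype V] [AddCommGroup E] [Module ℝ E]
    {τ : Finset V} {t : V → ℝ} (ht : ∀ v, t v ≠ 0 → v ∈ τ) (P : V → E) :
    ∑ v, t v • P v = ∑ v : τ, t v • P v := by
  rw [Finset.sum_coe_sort τ fun v => t v • P v]
  refine (Finset.sum_subset (Finset.subset_univ τ) fun v _ hv => ?_).symm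
  rw [show t v = 0 from by_contra fun h => hv (ht v h), zero_smul]

namespace ThreeManifoldTriangulation

variable {Y : Type*} [TopologicalSpace Y] {V : Type*} [Fintype V] [DecidableEq V]
variable {T : ThreeManifoldTriangulation Y V} {o : T.Orientation} {l : Finset V → ℝ}
  {s : Finset V → ℤˣ} {p q : V → Fin 4 → ℝ} {σ τ : Finset V}

/-! ### Developments of stars and of the whole complex -/

theorem preconnectedSpace_link (hσ : σ ∈ T.complex) (hcard : σ.card ≤ 2) :
    PreconnectedSpace (T.complex.link σ).realization := by
  obtain ⟨-, ⟨e⟩⟩ := T.isClosedThreeManifold σ hσ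
  have h : IsPreconnected (Metric.sphere (0 : EuclideanSpace ℝ (Fin (4 - σ.card))) 1) := by
    refine (isConnected_sphere ?_ 0 zero_le_one).isPreconnected
    rw [← Module.finrank_eq_rank, finrank_euclideanSpace_fin]
    exact_mod_cast (show 1 < 4 - σ.card by omega)
  have := isPreconnected_iff_preconnectedSpace.1 h
  exact e.symm.surjective.denseRange.preconnectedSpace e.symm.continuous

theorem cocyclesTrivial_link (hσ : σ ∈ T.complex) (hcard : σ.card = 1) (ι G : Type*) [Group G] :
    CocyclesTrivial (T.complex.link σ).realization ι G := by
  obtain ⟨-, ⟨e⟩⟩ := T.isClosedThreeManifold σ hσ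
  exact (CocyclesTrivial.sphere_two _ (by omega)).of_homeomorph e.symm

theorem link_empty : T.complex.link ∅ = T.complex := by
  ext ρ
  change (ρ.Nonempty ∧ Disjoint ρ ∅ ∧ ρ ∪ ∅ ∈ T.complex) ↔ ρ ∈ T.complex
  rw [Finset.union_empty]
  exact ⟨fun h => h.2.2, fun h => ⟨PreAbstractSimplicialComplex.nonempty_of_mem h,
    Finset.disjoint_empty_right ρ, h⟩⟩

/-- Induction on the codimension: triangles and tetrahedra are handled directly, and the links of
edges and vertices are connected spheres. -/
theorem hasUniqueDevelopment_of_mem (hσ : σ ∈ T.complex) : HasUniqueDevelopment o l s σ := by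
  induction h : 4 - σ.card generalizing σ with
  | zero => exact hasUniqueDevelopment_of_three_le_card hσ (by omega)
  | succ n ih =>
    by_cases h3 : 3 ≤ σ.card
    · exact hasUniqueDevelopment_of_three_le_card hσ h3
    · have := preconnectedSpace_link hσ (by omega)
      refine hasUniqueDevelopment_of_link (by omega) fun w hw => ?_
      have hw' := mem_link_singleton.1 hw
      exact ih hw'.2 (by rw [Finset.card_insert_of_notMem hw'.1]; omega)

theorem simplyConnectedSpace_realization [SimplyConnectedSpace Y] :
    SimplyConnectedSpace T.complex.realization :=
  T.homeo.toHomotopyEquiv.simplyConnectedSpace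

theorem hasUniqueDevelopment_empty [SimplyConnectedSpace Y] :
    HasUniqueDevelopment o l s ∅ := by
  have : SimplyConnectedSpace T.complex.realization := simplyConnectedSpace_realization
  have : PreconnectedSpace (T.complex.link ∅).realization := by
    rw [link_empty]
    infer_instance
  exact hasUniqueDevelopment_of_link (by simp) fun w hw =>
    hasUniqueDevelopment_of_mem (mem_link_singleton.1 hw).2

/-- The edge developments at `v` glue over its link, a two-sphere on which cocycles are trivial. -/
theorem exists_development_vertex (o : T.Orientation) (hl : T.IsLabelling l)
    (hflat : T.IsFlat l s) {v : V} (hv : {v} ∈ T.complex) : ∃ p, IsDevelopment o l s {v} p := by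
  have := preconnectedSpace_link hv (by simp)
  refine exists_development_of_link (by simp) (cocyclesTrivial_link hv (by simp) _ _)
    (fun i j hij => hasUniqueDevelopment_of_mem (insert_insert_mem hij)) fun w hw => ?_
  have hw' := mem_link_singleton.1 hw
  have hne : w ≠ v := by simpa using hw'.1
  have := preconnectedSpace_link hw'.2 (Finset.card_pair hne).le
  exact exists_development_edge o hl hflat hne hw'.2

theorem exists_development [SimplyConnectedSpace Y] (o : T.Orientation) (hl : T.IsLabelling l)
    (hflat : T.IsFlat l s) : ∃ p, IsDevelopment o l s ∅ p := by
  have : SimplyConnectedSpace T.complex.realization := simplyConnectedSpace_realization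
  have : PreconnectedSpace (T.complex.link ∅).realization := by
    rw [link_empty]
    infer_instance
  refine exists_development_of_link (by simp) ?_
    (fun i j hij => hasUniqueDevelopment_of_mem (insert_insert_mem hij)) fun w hw => ?_
  · rw [link_empty]
    exact CocyclesTrivial.of_simplyConnectedSpace
  · exact exists_development_vertex o hl hflat (mem_link_singleton.1 hw).2

/-! ### The spherical map defined by vertex positions -/

section SphericalMap

variable {P : V → S3}

theorem exists_tet_of_realization (t : T.complex.realization) :
    ∃ τ ∈ T.Tet, ∀ v, t.1 v ≠ 0 → v ∈ τ := by
  obtain ⟨-, σ, hσ, ht⟩ := t.2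
  obtain ⟨τ, hτ, hsub⟩ := exists_tet_of_mem hσ
  exact ⟨τ, hτ, fun v hv => hsub (ht v hv)⟩

theorem sum_smul_ne_zero (hP : ∀ τ ∈ T.Tet, LinearIndependent ℝ fun v : τ => (P v : E4))
    (t : T.complex.realization) : ∑ v, t.1 v • (P v : E4) ≠ 0 := by
  intro h0
  obtain ⟨τ, hτ, ht⟩ := exists_tet_of_realization t
  rw [sum_smul_coe_eq_sum_subtype ht] at h0
  have h1 := Fintype.linearIndependent_iff.1 (hP τ hτ) (fun v => t.1 v) h0
  have h2 : ∀ v, t.1 v = 0 := fun v => by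
    by_contra hv
    exact hv (h1 ⟨v, ht v hv⟩)
  have h3 := t.2.1.2
  simp [h2] at h3

/-- The map which is the standard parametrization of the spherical simplex with vertices `P v` on
every simplex. -/
def sphericalMap (T : ThreeManifoldTriangulation Y V) (P : V → S3)
    (hP : ∀ τ ∈ T.Tet, LinearIndependent ℝ fun v : τ => (P v : E4)) (y : Y) : S3 :=
  ⟨NormedSpace.normalize (∑ v, (T.homeo.symm y).1 v • (P v : E4)), by
    simpa using NormedSpace.norm_normalize (sum_smul_ne_zero hP (T.homeo.symm y))⟩

theorem continuous_sphericalMap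
    (hP : ∀ τ ∈ T.Tet, LinearIndependent ℝ fun v : τ => (P v : E4)) :
    Continuous (sphericalMap T P hP) := by
  have h1 : Continuous fun y => ∑ v, (T.homeo.symm y).1 v • (P v : E4) :=
    continuous_finsetSum _ fun v _ => (((continuous_apply v).comp continuous_subtype_val).comp
      T.homeo.symm.continuous).smul continuous_const
  refine Continuous.subtype_mk ?_ _
  exact (h1.norm.inv₀ fun y => norm_ne_zero_iff.2 (sum_smul_ne_zero hP _)).smul h1

/-- By linear independence, equal directions mean proportional barycentric coordinates, and these
sum to one. -/
theorem injOn_sphericalMap (hP : ∀ τ ∈ T.Tet, LinearIndependent ℝ fun v : τ => (P v : E4))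
    (hτ : τ ∈ T.Tet) : Set.InjOn (sphericalMap T P hP) (T.cell τ) := by
  rintro _ ⟨t, ht, rfl⟩ _ ⟨t', ht', rfl⟩ h
  have h1 := congrArg Subtype.val h
  simp only [sphericalMap, T.homeo.symm_apply_apply, NormedSpace.normalize] at h1
  set r := ‖∑ v, t.1 v • (P v : E4)‖⁻¹ with hr
  set r' := ‖∑ v, t'.1 v • (P v : E4)‖⁻¹ with hr'
  have hr0 : r ≠ 0 := inv_ne_zero (norm_ne_zero_iff.2 (sum_smul_ne_zero hP t))
  rw [sum_smul_coe_eq_sum_subtype ht, sum_smul_coe_eq_sum_subtype ht', Finset.smul_sum,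
    Finset.smul_sum, ← sub_eq_zero, ← Finset.sum_sub_distrib] at h1
  simp only [smul_smul, ← sub_smul] at h1
  have h2 := Fintype.linearIndependent_iff.1 (hP τ hτ) (fun v => r * t.1 v - r' * t'.1 v) h1
  have h3 : ∀ v, r * t.1 v = r' * t'.1 v := by
    intro v
    by_cases hv : v ∈ τ
    · exact sub_eq_zero.1 (h2 ⟨v, hv⟩)
    · rw [show t.1 v = 0 from by_contra fun h => hv (ht v h),
        show t'.1 v = 0 from by_contra fun h => hv (ht' v h), mul_zero, mul_zero]
  have h4 : r = r' := by
    have := Finset.sum_congr rfl fun v (_ : v ∈ Finset.univ) => h3 v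
    rwa [← Finset.mul_sum, ← Finset.mul_sum, t.2.1.2, t'.2.1.2, mul_one, mul_one] at this
  congr 1
  ext v
  exact mul_left_cancel₀ hr0 ((h3 v).trans (by rw [h4]))

theorem isCompact_cell (τ : Finset V) : IsCompact (T.cell τ) := by
  have : CompactSpace T.complex.realization :=
    isCompact_iff_compactSpace.1 PreAbstractSimplicialComplex.isCompact_realization
  refine IsCompact.image (IsClosed.isCompact ?_) T.homeo.continuous
  have : {t : T.complex.realization | ∀ v, t.1 v ≠ 0 → v ∈ τ} =
      ⋂ v, ⋂ (_ : v ∉ τ), {t | t.1 v = 0} := by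
    ext t
    simp only [Set.mem_iInter]
    exact ⟨fun h v hv => by_contra fun h' => hv (h v h'),
      fun h v hv => by_contra fun h' => hv (h v h')⟩
  rw [this]
  exact isClosed_iInter fun v => isClosed_iInter fun _ =>
    isClosed_eq ((continuous_apply v).comp continuous_subtype_val) continuous_const

theorem isEmbedding_sphericalMap
    (hP : ∀ τ ∈ T.Tet, LinearIndependent ℝ fun v : τ => (P v : E4)) (hτ : τ ∈ T.Tet) :
    Topology.IsEmbedding ((T.cell τ).domRestrict (sphericalMap T P hP)) := by
  have := isCompact_iff_compactSpace.1 (isCompact_cell (T := T) τ)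
  refine (Continuous.isClosedEmbedding ?_ ?_).isEmbedding
  · exact (continuous_sphericalMap hP).comp continuous_subtype_val
  · exact Set.injOn_iff_injective.1 (injOn_sphericalMap hP hτ)

theorem IsDevelopment.isSphericalMap (hl : T.IsLabelling l) (hp : IsDevelopment o l s ∅ p)
    (hP : ∀ τ ∈ T.Tet, LinearIndependent ℝ fun v : τ => (toSphere p v : E4)) :
    T.IsSphericalMap o l s (sphericalMap T (toSphere p) hP) := by
  refine ⟨continuous_sphericalMap hP, fun τ hτ => isEmbedding_sphericalMap hP hτ, toSphere p,
    fun t => ?_, fun τ hτ => ?_, fun τ hτ x hx => ?_⟩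
  · simp [sphericalMap]
  · obtain ⟨x, hx⟩ := exists_isOrdering hτ.2
    exact (hp τ hτ (Finset.empty_subset _) x hx).isRealization hl hτ hx
  · have h := hp τ hτ (Finset.empty_subset _) x hx
    convert h.2 using 3
    ext i j
    simp [frame, h.coe_toSphere hx (hx.mem i)]

end SphericalMap

theorem norm_toLp_mulVec {A : Matrix (Fin 4) (Fin 4) ℝ}
    (hA : A ∈ specialOrthogonalGroup (Fin 4) ℝ) (u : Fin 4 → ℝ) :
    ‖WithLp.toLp 2 (A *ᵥ u)‖ = ‖WithLp.toLp 2 u‖ := by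
  rw [@norm_eq_sqrt_real_inner E4, @norm_eq_sqrt_real_inner E4, EuclideanSpace.inner_toLp_toLp,
    EuclideanSpace.inner_toLp_toLp, star_trivial, star_trivial, dotProduct_mulVec,
    vecMul_mulVec, mul_transpose_self_of_specialOrthogonal hA]
  simp

end ThreeManifoldTriangulation

open ThreeManifoldTriangulation in
theorem mainTheorem4 {Y : Type*} [TopologicalSpace Y] [SimplyConnectedSpace Y]
    {V : Type*} [Fintype V] [DecidableEq V]
    (T : ThreeManifoldTriangulation Y V) (o : T.Orientation)
    (l : Finset V → ℝ) (s : Finset V → ℤˣ)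
    (hl : T.IsLabelling l) (hflat : T.IsFlat l s) :
    ∃ φ : Y → S3, T.IsSphericalMap o l s φ ∧
      ∀ φ' : Y → S3, T.IsSphericalMap o l s φ' →
        ∃ A ∈ Matrix.specialOrthogonalGroup (Fin 4) ℝ,
          ∀ y : Y, (φ' y : E4).ofLp = A *ᵥ (φ y : E4).ofLp := by
  obtain ⟨p, hp⟩ := exists_development o hl hflat
  have hP : ∀ τ ∈ T.Tet, LinearIndependent ℝ fun v : τ => (toSphere p v : E4) := by
    intro τ hτ
    obtain ⟨x, hx⟩ := exists_isOrdering hτ.2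
    exact ((hp τ hτ (Finset.empty_subset _) x hx).isRealization hl hτ hx).1
  refine ⟨sphericalMap T (toSphere p) hP, hp.isSphericalMap hl hP, ?_⟩
  rintro φ' ⟨-, -, P', hφ', hreal, hdet⟩
  -- The vertex images of the second map form another development of the whole complex.
  obtain ⟨A, hA, hpq⟩ := hasUniqueDevelopment_empty p (fun v => (P' v : E4).ofLp) hp
    fun τ hτ _ x hx => (hreal τ hτ).isOrientedFrame hx (hdet τ hτ x hx)
  refine ⟨A, hA, fun y => ?_⟩
  obtain ⟨t, rfl⟩ := T.homeo.surjective y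
  -- The rotation relates the positions only at vertices of tetrahedra, so the sum is first
  -- restricted to a tetrahedron containing the point. Normalization then commutes with the isometry
  -- `A`.
  have hsum : ∑ v, t.1 v • (P' v : E4) =
      WithLp.toLp 2 (A *ᵥ (∑ v, t.1 v • (toSphere p v : E4)).ofLp) := by
    obtain ⟨τ, hτ, ht⟩ := exists_tet_of_realization t
    obtain ⟨x, hx⟩ := exists_isOrdering hτ.2
    have h := hp τ hτ (Finset.empty_subset _) x hx
    rw [sum_smul_coe_eq_sum_subtype ht, sum_smul_coe_eq_sum_subtype ht]
    apply WithLp.ofLp_injective 2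
    simp only [WithLp.ofLp_sum, WithLp.ofLp_smul, mulVec_sum, mulVec_smul]
    refine Finset.sum_congr rfl fun v _ => ?_
    rw [hpq τ hτ (Finset.empty_subset _) v v.2, h.coe_toSphere hx v.2]
  rw [hφ', hsum]
  simp only [sphericalMap, T.homeo.symm_apply_apply, NormedSpace.normalize, norm_toLp_mulVec hA,
    WithLp.ofLp_smul, mulVec_smul, WithLp.toLp_ofLp]

end
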